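/- Let $M$ be a compact smooth $n$-manifold (without boundary), $I=[0,T]$ with $T>0$, and let $g(t)$, $t\in I$, be a smooth Ricci flow on $M$, i.e. $\partial_t g=-2\,\mathrm{Ric}_{g(t)}$. Let $\hat g=g(t)+dt^2$ be the metric on $M\times I$ that is the orthogonal sum of the metrics $g(t)$ and the standard metric on $I$; let $\nabla$ be the Levi-Civita connection of $\hat g$ and $\nabla^g$ that of $g(t)$ on $M$. Let $c\colon S^1\times I\to M$ be a smooth family of immersed closed curves, with $X=\partial_x c$, unit tangent vector $S=X/|X|_{g(t)}$, curvature vector $H=\nabla^g_SS$ and curvature $k=|H|_{g(t)}$, that satisfies the curve-shrinking equation $\partial_t c=H$. Write $f'=|X|^{-1}\partial_x f$ for the arc-length derivative of a function $f$ on $S^1\times I$. Regard $S$ and $H$ as horizontal vector fields along the surface $(x,t)\mapsto(c(x,t),t)$ in $M\times I$, and let $(\nabla_SH)^\perp$ be the component of $\nabla_SH$ that is $\hat g$-orthogonal to $S$. Then there is a constant $\widehat C<\infty$, depending only on the Ricci flow $(M,g(t))_{t\in I}$ and not on $c$, such that on all of $S^1\times I$ $$\frac{\partial}{\partial t}k^2\le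 (k^2)''-2\bigl|(\nabla_SH)^\perp\bigr|_{\hat g}^2+2k^4+\widehat C\,(k^2+k),$$ where the time derivative is one-sided at $t=0$ and $t=T$. Moreover $\widehat C$ can be chosen to depend only on the dimension $n$ and on a common bound $K$ over $M\times I$ for the curvature tensor of $g(t)$ and for its first covariant derivative, that is, on $K$ with $|\langle R(u,v)w,z\rangle|\le K$ and $|\langle(\nabla^g_aR)(u,v)w,z\rangle|\le K$ for all $g(t)$-unit vectors $a,u,v,w,z$. -/

import Mathlib

open scoped Manifold ContDiff Matrix

namespace CurveShrinking

noncomputable section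

/-! ### Local Riemannian geometry in coordinates -/

/-- The coordinate space `ℝⁿ` on which an `n`-dimensional manifold is modelled. -/
abbrev Coord (n : ℕ) : Type := EuclideanSpace ℝ (Fin n)

/-- The Christoffel symbol `Γᵏᵢⱼ = ½ gᵏˡ (∂ᵢ gⱼₗ + ∂ⱼ gᵢₗ - ∂ₗ gᵢⱼ)` at a point where the metric has
the matrix `G` and the partial derivatives `dG m = ∂ₘ g`. -/
def christoffel {ι : Type} [Fintype ι] [DecidableEq ι] (G : Matrix ι ι ℝ) (dG : ι → Matrix ι ι ℝ)
    (k i j : ι) : ℝ :=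
  (1 / 2) * ∑ l, G⁻¹ k l * (dG i j l + dG j i l - dG l i j)

/-- The inner product `gᵢⱼ uⁱ vʲ`. -/
def pairing {ι : Type} [Fintype ι] (G : Matrix ι ι ℝ) (u v : ι → ℝ) : ℝ :=
  ∑ i, ∑ j, G i j * u i * v j

/-- Covariant derivative in the direction `S` of a vector field `V` along a curve with tangent
vector `S`: here `dV` holds the derivatives of the components of `V` in the direction `S`, and
`(∇_S V)ᵏ = dVᵏ + Γᵏᵢⱼ Sⁱ Vʲ`. -/
def covariant {ι : Type} [Fintype ι] (Γ : ι → ι → ι → ℝ) (S V dV : ι → ℝ) (k : ι) : ℝ :=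
  dV k + ∑ i, ∑ j, Γ k i j * S i * V j

section Local

variable {n : ℕ}

/-- The partial derivative `∂ᵢ f` at `y`. -/
def partialDeriv (i : Fin n) (f : Coord n → ℝ) (y : Coord n) : ℝ :=
  fderiv ℝ f y (EuclideanSpace.single i 1)

/-- The Christoffel symbols `Γᵏᵢⱼ` at `y` of a field `G` of metric matrices. -/
def localChristoffel (G : Coord n → Matrix (Fin n) (Fin n) ℝ) (y : Coord n) (k i j : Fin n) : ℝ :=
  christoffel (G y) (fun m => Matrix.of fun a b => partialDeriv m (fun z => G z a b) y) k i j

/-- The component `Rᵢⱼₖˡ` of the Riemann tensor, `R(eᵢ, eⱼ) eₖ = Rᵢⱼₖˡ eₗ`, with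
`R(X, Y) Z = ∇_X ∇_Y Z - ∇_Y ∇_X Z - ∇_[X,Y] Z`. -/
def localRiem (G : Coord n → Matrix (Fin n) (Fin n) ℝ) (y : Coord n) (i j k l : Fin n) : ℝ :=
  partialDeriv i (fun z => localChristoffel G z l j k) y
    - partialDeriv j (fun z => localChristoffel G z l i k) y
    + ∑ m, (localChristoffel G y l i m * localChristoffel G y m j k
      - localChristoffel G y l j m * localChristoffel G y m i k)

/-- The component `Ricⱼₖ = Rᵢⱼₖⁱ` of the Ricci tensor, `Ric(Y, Z) = tr (X ↦ R(X, Y) Z)`. -/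
def localRic (G : Coord n → Matrix (Fin n) (Fin n) ℝ) (y : Coord n) (j k : Fin n) : ℝ :=
  ∑ i, localRiem G y i j k i

/-- The component `∇ₘ Rᵢⱼₖˡ` of the covariant derivative of the Riemann tensor. -/
def localCovRiem (G : Coord n → Matrix (Fin n) (Fin n) ℝ) (y : Coord n) (m i j k l : Fin n) : ℝ :=
  partialDeriv m (fun z => localRiem G z i j k l) y
    + ∑ a, (localChristoffel G y l m a * localRiem G y i j k a
      - localChristoffel G y a m i * localRiem G y a j k l
      - localChristoffel G y a m j * localRiem G y i a k l
      - localChristoffel G y a m k * localRiem G y i j a l)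

/-- `⟨R(u, v) w, z⟩` at `y`. -/
def localRm (G : Coord n → Matrix (Fin n) (Fin n) ℝ) (y : Coord n) (u v w z : Fin n → ℝ) : ℝ :=
  pairing (G y) (fun l => ∑ i, ∑ j, ∑ k, localRiem G y i j k l * u i * v j * w k) z

/-- `⟨(∇_a R)(u, v) w, z⟩` at `y`. -/
def localCovRm (G : Coord n → Matrix (Fin n) (Fin n) ℝ) (y : Coord n)
    (a u v w z : Fin n → ℝ) : ℝ :=
  pairing (G y)
    (fun l => ∑ m, ∑ i, ∑ j, ∑ k, localCovRiem G y m i j k l * a m * u i * v j * w k) z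

end Local

/-! ### Ricci flows -/

section Manifold

variable {n : ℕ} {M : Type*} [TopologicalSpace M] [ChartedSpace (Coord n) M] [IsManifold (𝓡 n) ∞ M]

variable (n M) in
/-- A one-parameter family `g(t)` of smooth Riemannian metrics on `M`. Only its values for `t` in
the time interval `[0, T]` under consideration are ever used. -/
abbrev MetricFamily : Type _ :=
  ℝ → Bundle.ContMDiffRiemannianMetric (𝓡 n) ∞ (Coord n) (fun p : M => TangentSpace (𝓡 n) p)

/-- The matrix `gᵢⱼ` of the metric `g(t)` in the chart at `p`, as a function of the coordinates `y`
(meaningful on the target of that chart): the inner products of the coordinate vector fields. -/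
def chartMetric (g : MetricFamily n M) (p : M) (t : ℝ) (y : Coord n) :
    Matrix (Fin n) (Fin n) ℝ :=
  Matrix.of fun i j =>
    (g t).inner ((chartAt (Coord n) p).symm y)
      (mfderiv 𝓘(ℝ, Coord n) (𝓡 n) (chartAt (Coord n) p).symm y (EuclideanSpace.single i 1))
      (mfderiv 𝓘(ℝ, Coord n) (𝓡 n) (chartAt (Coord n) p).symm y (EuclideanSpace.single j 1))

/-- `g` is a Ricci flow on `M × [0, T]`: it is smooth on `M × [0, T]`, and `∂g/∂t = -2 Ric`
(with one-sided derivatives at the two end times). -/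
structure IsRicciFlow (T : ℝ) (g : MetricFamily n M) : Prop where
  smooth : ∀ (p : M) (i j : Fin n),
    ContDiffOn ℝ ∞ (fun q : ℝ × Coord n => chartMetric g p q.1 q.2 i j)
      (Set.Icc 0 T ×ˢ (chartAt (Coord n) p).target)
  evolution : ∀ (p : M), ∀ y ∈ (chartAt (Coord n) p).target, ∀ t ∈ Set.Icc 0 T, ∀ i j : Fin n,
    HasDerivWithinAt (fun s => chartMetric g p s y i j)
      (-2 * localRic (chartMetric g p t) y i j) (Set.Icc 0 T) t

/-- The curvature tensor and its first covariant derivative are bounded by `K` on `M × [0, T]`: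
`|⟨R(u, v) w, z⟩| ≤ K` and `|⟨(∇_a R)(u, v) w, z⟩| ≤ K` for all `g(t)`-unit vectors. -/
def CurvatureBoundedBy (T : ℝ) (g : MetricFamily n M) (K : ℝ) : Prop :=
  ∀ (p : M), ∀ t ∈ Set.Icc 0 T, ∀ a u v w z : Fin n → ℝ,
    (∀ b ∈ [a, u, v, w, z], pairing (chartMetric g p t (chartAt (Coord n) p p)) b b = 1) →
      |localRm (chartMetric g p t) (chartAt (Coord n) p p) u v w z| ≤ K ∧
      |localCovRm (chartMetric g p t) (chartAt (Coord n) p p) a u v w z| ≤ K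

/-! ### The space-time metric -/

/-- The matrix of the metric `ĝ = g(t) + dt²` on `M × [0, T]`, in the coordinates given by the chart
at `p` (indices `Sum.inl i`) and by `t` (index `Sum.inr ()`). -/
def hatMetric (g : MetricFamily n M) (p : M) (t : ℝ) (y : Coord n) :
    Matrix (Fin n ⊕ Unit) (Fin n ⊕ Unit) ℝ :=
  Matrix.fromBlocks (chartMetric g p t y) 0 0 1

/-- The partial derivatives of the components of `ĝ` in the directions of `M` and of time. -/
def hatMetricDeriv (T : ℝ) (g : MetricFamily n M) (p : M) (t : ℝ) (y : Coord n) :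
    Fin n ⊕ Unit → Matrix (Fin n ⊕ Unit) (Fin n ⊕ Unit) ℝ :=
  Sum.elim
    (fun m => Matrix.of fun a b => partialDeriv m (fun z => hatMetric g p t z a b) y)
    (fun _ => Matrix.of fun a b => derivWithin (fun s => hatMetric g p s y a b) (Set.Icc 0 T) t)

/-- The Christoffel symbols of `ĝ`. -/
def hatChristoffel (T : ℝ) (g : MetricFamily n M) (p : M) (t : ℝ) (y : Coord n)
    (k i j : Fin n ⊕ Unit) : ℝ :=
  christoffel (hatMetric g p t y) (hatMetricDeriv T g p t y) k i j

/-- A vector tangent to `M`, seen as a horizontal vector of `M × [0, T]`. -/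
def horizontal (v : Fin n → ℝ) : Fin n ⊕ Unit → ℝ :=
  Sum.elim v 0

/-! ### Families of closed curves

A family of closed curves is a map `c : Circle → ℝ → M`; the circle is parametrized by `x : ℝ`
through `Circle.exp x = exp (i x)`. The objects below are first written in the chart at a point `p`;
they have their geometric meaning at those `(x, t)` for which `c (Circle.exp x) t` lies in the domain
of that chart. -/

/-- The family of curves in the chart at `p`. -/
def chartCurve (c : Circle → ℝ → M) (p : M) (x t : ℝ) : Coord n :=
  chartAt (Coord n) p (c (Circle.exp x) t)

/-- The velocity `X = ∂c/∂x` in the chart at `p`. -/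
def chartVelocity (c : Circle → ℝ → M) (p : M) (x t : ℝ) (i : Fin n) : ℝ :=
  deriv (fun x' => (chartCurve c p x' t : Coord n) i) x

/-- The metric matrix at the point `c(x, t)`, in the chart at `p`. -/
def metricAlong (g : MetricFamily n M) (c : Circle → ℝ → M) (p : M) (x t : ℝ) :
    Matrix (Fin n) (Fin n) ℝ :=
  chartMetric g p t (chartCurve c p x t)

/-- The speed `|X|`, computed in the chart at `p`. -/
def chartSpeed (g : MetricFamily n M) (c : Circle → ℝ → M) (p : M) (x t : ℝ) : ℝ :=
  √(pairing (metricAlong g c p x t) (chartVelocity c p x t) (chartVelocity c p x t))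

/-- The unit tangent vector `S = X / |X|` in the chart at `p`. -/
def chartTangent (g : MetricFamily n M) (c : Circle → ℝ → M) (p : M) (x t : ℝ) (i : Fin n) : ℝ :=
  (chartSpeed g c p x t)⁻¹ * chartVelocity c p x t i

/-- The curvature vector `H = ∇^g_S S` in the chart at `p`. -/
def chartCurvatureVector (g : MetricFamily n M) (c : Circle → ℝ → M) (p : M) (x t : ℝ) :
    Fin n → ℝ :=
  covariant (localChristoffel (chartMetric g p t) (chartCurve c p x t))
    (chartTangent g c p x t) (chartTangent g c p x t)
    (fun k => (chartSpeed g c p x t)⁻¹ * deriv (fun x' => chartTangent g c p x' t k) x)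

/-- The vector `∇_S H` tangent to `M × [0, T]`, where `∇` is the Levi-Civita connection of `ĝ`, in
the chart at `p`. -/
def chartNablaSH (T : ℝ) (g : MetricFamily n M) (c : Circle → ℝ → M) (p : M) (x t : ℝ) :
    Fin n ⊕ Unit → ℝ :=
  covariant (hatChristoffel T g p t (chartCurve c p x t))
    (horizontal (chartTangent g c p x t)) (horizontal (chartCurvatureVector g c p x t))
    (fun k => (chartSpeed g c p x t)⁻¹ *
      deriv (fun x' => horizontal (chartCurvatureVector g c p x' t) k) x)

/-- The component `(∇_S H)^⊥` of `∇_S H` that is `ĝ`-orthogonal to the curve, in the chart at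
`p`. -/
def chartNablaSHPerp (T : ℝ) (g : MetricFamily n M) (c : Circle → ℝ → M) (p : M) (x t : ℝ) :
    Fin n ⊕ Unit → ℝ :=
  fun k => chartNablaSH T g c p x t k
    - pairing (hatMetric g p t (chartCurve c p x t)) (chartNablaSH T g c p x t)
        (horizontal (chartTangent g c p x t)) * horizontal (chartTangent g c p x t) k

/-- `c` is a smooth family of immersed closed curves on `[0, T]` that satisfies the curve-shrinking
equation `∂c/∂t = H` with respect to the metrics `g(t)`. -/
structure IsCurveShrinkingFlow (T : ℝ) (g : MetricFamily n M) (c : Circle → ℝ → M) : Prop where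
  smooth : ContMDiffOn ((𝓡 1).prod 𝓘(ℝ, ℝ)) (𝓡 n) ∞ (fun q : Circle × ℝ => c q.1 q.2)
    (Set.univ ×ˢ Set.Icc 0 T)
  immersed : ∀ (p : M) (x : ℝ), ∀ t ∈ Set.Icc 0 T,
    c (Circle.exp x) t ∈ (chartAt (Coord n) p).source →
      (chartVelocity c p x t : Fin n → ℝ) ≠ 0
  equation : ∀ (p : M) (x : ℝ), ∀ t ∈ Set.Icc 0 T,
    c (Circle.exp x) t ∈ (chartAt (Coord n) p).source → ∀ i : Fin n,
      HasDerivWithinAt (fun s => (chartCurve c p x s : Coord n) i)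
        (chartCurvatureVector g c p x t i) (Set.Icc 0 T) t

/-! The scalar functions of `(x, t)`, each computed at `(x, t)` in the chart at `c(x, t)`. -/

/-- The speed `|X|`. -/
def speed (g : MetricFamily n M) (c : Circle → ℝ → M) (x t : ℝ) : ℝ :=
  chartSpeed g c (c (Circle.exp x) t) x t

/-- The curvature `k = |H|`. -/
def curvature (g : MetricFamily n M) (c : Circle → ℝ → M) (x t : ℝ) : ℝ :=
  √(pairing (metricAlong g c (c (Circle.exp x) t) x t)
    (chartCurvatureVector g c (c (Circle.exp x) t) x t)
    (chartCurvatureVector g c (c (Circle.exp x) t) x t))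

/-- The quantity `|(∇_S H)^⊥|²`, the norm being that of `ĝ`. -/
def nablaSHPerpSq (T : ℝ) (g : MetricFamily n M) (c : Circle → ℝ → M) (x t : ℝ) : ℝ :=
  pairing (hatMetric g (c (Circle.exp x) t) t (chartCurve c (c (Circle.exp x) t) x t))
    (chartNablaSHPerp T g c (c (Circle.exp x) t) x t)
    (chartNablaSHPerp T g c (c (Circle.exp x) t) x t)

/-- The arc-length derivative `f' = ∂f/∂s = |X|⁻¹ ∂f/∂x` of a function `f` of `(x, t)`. -/
def arcDeriv (g : MetricFamily n M) (c : Circle → ℝ → M) (f : ℝ → ℝ → ℝ) (x t : ℝ) : ℝ :=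
  (speed g c x t)⁻¹ * deriv (fun x' => f x' t) x

/-- The inequality `∂ₜ k² ≤ (k²)'' - 2 |(∇_S H)^⊥|² + 2 k⁴ + C (k² + k)` at all `(x, t)` with
`t ∈ [0, T]`. -/
def CurvatureInequality (T : ℝ) (g : MetricFamily n M) (c : Circle → ℝ → M) (C : ℝ) : Prop :=
  ∀ (x : ℝ), ∀ t ∈ Set.Icc 0 T,
    derivWithin (fun s => curvature g c x s ^ 2) (Set.Icc 0 T) t ≤
      arcDeriv g c (arcDeriv g c fun x' t' => curvature g c x' t' ^ 2) x t
        - 2 * nablaSHPerpSq T g c x t + 2 * curvature g c x t ^ 4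
        + C * (curvature g c x t ^ 2 + curvature g c x t)

end Manifold

end

end CurveShrinking

/-! Write `D_x`, `D_t` for the covariant derivatives along `(x, t) ↦ c(x, t)` taken with the
connection of `g(t)` on `M`. Three facts drive the computation. The product rule for `D_t` carries
an extra `-2 Ric`, since the metric itself moves (`IsFlow.hasDerivWithinAt_pairing`). The connection
is torsion-free, so `D_t X = D_x H` (`IsFlow.covT_velocity`). The commutator `[D_t, D_x]` is `R(H,
X)` plus the time derivative of the Christoffel symbols (`IsFlow.covT_covX`), and differentiating
the Koszul formula in time expresses the latter through `∇Ric`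
(`LocalRicciFlow.pairing_christoffelDot`).

Hence `∂ₜ|X| = -(Ric(S, S) + k²)|X|` and `D_t S = ∇_S H + (Ric(S, S) + k²) S`. The commutator
applied to `S`, paired with `H`, gives `⟨D_t H, H⟩ = ⟨∇_S ∇_S H, H⟩ + 2 (Ric(S, S) + k²) k² + ⟨R(H,
S) S, H⟩ - 2 (∇_S Ric)(S, H) + (∇_H Ric)(S, S)`. On the other side `(k²)'' = 2⟨∇_S ∇_S H, H⟩ + 2|∇_S
H|²`. The connection of `ĝ` adds to `∇_S H` the time component `Ric(S, H)`, because `-½ ∂ₜ g = Ric`,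
and `⟨∇_S H, S⟩ = -k²`. Therefore `|(∇_S H)^⊥|² = |∇^g_S H|² - k⁴ + Ric(S, H)²`. Altogether this is
an exact formula for `∂ₜ k²` (`IsFlow.curvature_evolution`), whose remaining terms are linear or
quadratic in `H`, with coefficients controlled by the curvature and its first derivative. No
division by `k` occurs, so zeros of `H` need no separate evolution argument.

All of this is computed in a fixed chart. The scalar functions in the statement use the chart at the
moving point `c(x, t)`, so they have to be shown independent of the chart before they can be
differentiated. The bounds come either from `K` directly or, on a compact manifold, from finitely
many coordinate balls. -/

namespace CurveShrinking

noncomputable section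

/-! ### Algebra of the coordinate expressions -/

section Algebra

variable {ι : Type} [Fintype ι]

/-- The vector `Γ(u, v)` with the components `Γᵏᵢⱼ uⁱ vʲ`. -/
def conn (Γ : ι → ι → ι → ℝ) (u v : ι → ℝ) : ι → ℝ :=
  fun k => ∑ i, ∑ j, Γ k i j * u i * v j

/-- The derivative `wᵐ Dₘ` in the direction `w`, where `D` holds the partial derivatives. -/
def along {A : Type*} [AddCommMonoid A] [Module ℝ A] (D : ι → A) (w : ι → ℝ) : A :=
  ∑ m, w m • D m

lemma pairing_add_left (G : Matrix ι ι ℝ) (u u' v : ι → ℝ) :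
    pairing G (u + u') v = pairing G u v + pairing G u' v := by
  simp only [pairing, ← Finset.sum_add_distrib, Pi.add_apply]
  exact Finset.sum_congr rfl fun i _ => Finset.sum_congr rfl fun j _ => by ring

lemma pairing_add_right (G : Matrix ι ι ℝ) (u v v' : ι → ℝ) :
    pairing G u (v + v') = pairing G u v + pairing G u v' := by
  simp only [pairing, ← Finset.sum_add_distrib, Pi.add_apply]
  exact Finset.sum_congr rfl fun i _ => Finset.sum_congr rfl fun j _ => by ring

lemma pairing_smul_left (G : Matrix ι ι ℝ) (r : ℝ) (u v : ι → ℝ) :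
    pairing G (r • u) v = r * pairing G u v := by
  simp only [pairing, Finset.mul_sum, Pi.smul_apply, smul_eq_mul]
  exact Finset.sum_congr rfl fun i _ => Finset.sum_congr rfl fun j _ => by ring

lemma pairing_smul_right (G : Matrix ι ι ℝ) (r : ℝ) (u v : ι → ℝ) :
    pairing G u (r • v) = r * pairing G u v := by
  simp only [pairing, Finset.mul_sum, Pi.smul_apply, smul_eq_mul]
  exact Finset.sum_congr rfl fun i _ => Finset.sum_congr rfl fun j _ => by ring

lemma pairing_sub_left (G : Matrix ι ι ℝ) (u u' v : ι → ℝ) :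
    pairing G (u - u') v = pairing G u v - pairing G u' v := by
  simp only [pairing, ← Finset.sum_sub_distrib, Pi.sub_apply]
  exact Finset.sum_congr rfl fun i _ => Finset.sum_congr rfl fun j _ => by ring

lemma pairing_sub_right (G : Matrix ι ι ℝ) (u v v' : ι → ℝ) :
    pairing G u (v - v') = pairing G u v - pairing G u v' := by
  simp only [pairing, ← Finset.sum_sub_distrib, Pi.sub_apply]
  exact Finset.sum_congr rfl fun i _ => Finset.sum_congr rfl fun j _ => by ring

lemma pairing_add_matrix (G G' : Matrix ι ι ℝ) (u v : ι → ℝ) :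
    pairing (G + G') u v = pairing G u v + pairing G' u v := by
  simp only [pairing, ← Finset.sum_add_distrib, Matrix.add_apply]
  exact Finset.sum_congr rfl fun i _ => Finset.sum_congr rfl fun j _ => by ring

lemma pairing_smul_matrix (G : Matrix ι ι ℝ) (r : ℝ) (u v : ι → ℝ) :
    pairing (r • G) u v = r * pairing G u v := by
  simp only [pairing, Finset.mul_sum, Matrix.smul_apply, smul_eq_mul]
  exact Finset.sum_congr rfl fun i _ => Finset.sum_congr rfl fun j _ => by ring

lemma pairing_eq_dotProduct (G : Matrix ι ι ℝ) (u v : ι → ℝ) :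
    pairing G u v = u ⬝ᵥ G *ᵥ v := by
  simp only [pairing, dotProduct, Matrix.mulVec, Finset.mul_sum]
  exact Finset.sum_congr rfl fun i _ => Finset.sum_congr rfl fun j _ => by ring

lemma pairing_comm {G : Matrix ι ι ℝ} (hG : ∀ i j, G i j = G j i) (u v : ι → ℝ) :
    pairing G u v = pairing G v u := by
  simp only [pairing]
  rw [Finset.sum_comm]
  exact Finset.sum_congr rfl fun i _ => Finset.sum_congr rfl fun j _ => by rw [hG j i]; ring

lemma pairing_zero_left (G : Matrix ι ι ℝ) (v : ι → ℝ) : pairing G 0 v = 0 := by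
  simp [pairing]

lemma pairing_zero_right (G : Matrix ι ι ℝ) (v : ι → ℝ) : pairing G v 0 = 0 := by
  simp [pairing]

lemma conn_zero_left (Γ : ι → ι → ι → ℝ) (v : ι → ℝ) : conn Γ 0 v = 0 := by
  funext k
  simp [conn]

lemma conn_zero_right (Γ : ι → ι → ι → ℝ) (v : ι → ℝ) : conn Γ v 0 = 0 := by
  funext k
  simp [conn]

lemma conn_add_right (Γ : ι → ι → ι → ℝ) (u v v' : ι → ℝ) :
    conn Γ u (v + v') = conn Γ u v + conn Γ u v' := by
  funext k
  simp only [conn, ← Finset.sum_add_distrib, Pi.add_apply]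
  exact Finset.sum_congr rfl fun i _ => Finset.sum_congr rfl fun j _ => by ring

lemma conn_smul_left (Γ : ι → ι → ι → ℝ) (r : ℝ) (u v : ι → ℝ) :
    conn Γ (r • u) v = r • conn Γ u v := by
  funext k
  simp only [conn, Finset.mul_sum, Pi.smul_apply, smul_eq_mul]
  exact Finset.sum_congr rfl fun i _ => Finset.sum_congr rfl fun j _ => by ring

lemma conn_smul_right (Γ : ι → ι → ι → ℝ) (r : ℝ) (u v : ι → ℝ) :
    conn Γ u (r • v) = r • conn Γ u v := by
  funext k
  simp only [conn, Finset.mul_sum, Pi.smul_apply, smul_eq_mul]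
  exact Finset.sum_congr rfl fun i _ => Finset.sum_congr rfl fun j _ => by ring

lemma conn_add (Γ Γ' : ι → ι → ι → ℝ) (u v : ι → ℝ) :
    conn (Γ + Γ') u v = conn Γ u v + conn Γ' u v := by
  funext k
  simp only [conn, ← Finset.sum_add_distrib, Pi.add_apply]
  exact Finset.sum_congr rfl fun i _ => Finset.sum_congr rfl fun j _ => by ring

lemma conn_comm {Γ : ι → ι → ι → ℝ} (hΓ : ∀ k i j, Γ k i j = Γ k j i) (u v : ι → ℝ) :
    conn Γ u v = conn Γ v u := by
  funext k
  simp only [conn]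
  rw [Finset.sum_comm]
  exact Finset.sum_congr rfl fun i _ => Finset.sum_congr rfl fun j _ => by rw [hΓ k j i]; ring

lemma pairing_along (D : ι → Matrix ι ι ℝ) (w u v : ι → ℝ) :
    pairing (along D w) u v = ∑ m, w m * pairing (D m) u v := by
  simp only [pairing, along, Matrix.sum_apply, Matrix.smul_apply, smul_eq_mul, Finset.sum_mul,
    Finset.mul_sum]
  calc _ = ∑ i, ∑ m, ∑ j, w m * D m i j * u i * v j :=
        Finset.sum_congr rfl fun i _ => Finset.sum_comm
    _ = ∑ m, ∑ i, ∑ j, w m * D m i j * u i * v j := Finset.sum_comm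
    _ = _ := Finset.sum_congr rfl fun i _ => Finset.sum_congr rfl fun j _ =>
        Finset.sum_congr rfl fun j _ => by ring

lemma christoffel_comm [DecidableEq ι] (G : Matrix ι ι ℝ) (dG : ι → Matrix ι ι ℝ)
    (hd : ∀ m i j, dG m i j = dG m j i) (k i j : ι) :
    christoffel G dG k i j = christoffel G dG k j i := by
  simp only [christoffel]
  congr 1
  exact Finset.sum_congr rfl fun l _ => by rw [hd l i j]; ring

/-- Contracting with `G` cancels the inverse matrix in the Christoffel symbol; this is the Koszul
formula on coordinate vectors. -/
lemma sum_mul_christoffel [DecidableEq ι] {G : Matrix ι ι ℝ} (hG : ∀ i j, G i j = G j i)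
    (hdet : IsUnit G.det) (dG : ι → Matrix ι ι ℝ) (l i j : ι) :
    ∑ k, G k l * christoffel G dG k i j = (1 / 2) * (dG i j l + dG j i l - dG l i j) := by
  have h1 : ∀ m, ∑ k, G k l * G⁻¹ k m = if l = m then 1 else 0 := fun m => by
    have := congrFun (congrFun (Matrix.mul_nonsing_inv G hdet) l) m
    rw [Matrix.mul_apply, Matrix.one_apply] at this
    rw [← this]
    exact Finset.sum_congr rfl fun k _ => by rw [hG]
  simp only [christoffel, Finset.mul_sum]
  rw [Finset.sum_comm]
  calc _ = ∑ m, (∑ k, G k l * G⁻¹ k m) * ((1 / 2) * (dG i j m + dG j i m - dG m i j)) := by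
        refine Finset.sum_congr rfl fun m _ => ?_
        rw [Finset.sum_mul]
        exact Finset.sum_congr rfl fun k _ => by ring
    _ = _ := by simp [h1]

/-- The Koszul formula. -/
lemma pairing_conn_christoffel [DecidableEq ι] {G : Matrix ι ι ℝ} (hG : ∀ i j, G i j = G j i)
    (hdet : IsUnit G.det) (dG : ι → Matrix ι ι ℝ) (u v w : ι → ℝ) :
    pairing G (conn (christoffel G dG) u v) w
      = (1 / 2) * (pairing (along dG u) v w + pairing (along dG v) u w
        - pairing (along dG w) u v) := by
  -- The sums are reordered so that the innermost one is the contraction evaluated by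
  -- `sum_mul_christoffel`.
  have e1 : pairing G (conn (christoffel G dG) u v) w
      = ∑ i, ∑ j, ∑ l, (∑ k, G k l * christoffel G dG k i j) * (u i * v j * w l) := by
    simp only [pairing, conn, Finset.mul_sum, Finset.sum_mul]
    calc _ = ∑ l, ∑ k, ∑ i, ∑ j, G k l * (christoffel G dG k i j * u i * v j) * w l :=
          Finset.sum_comm
      _ = ∑ l, ∑ i, ∑ k, ∑ j, G k l * (christoffel G dG k i j * u i * v j) * w l :=
          Finset.sum_congr rfl fun l _ => Finset.sum_comm
      _ = ∑ i, ∑ l, ∑ k, ∑ j, G k l * (christoffel G dG k i j * u i * v j) * w l :=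
          Finset.sum_comm
      _ = ∑ i, ∑ l, ∑ j, ∑ k, G k l * (christoffel G dG k i j * u i * v j) * w l :=
          Finset.sum_congr rfl fun i _ => Finset.sum_congr rfl fun l _ => Finset.sum_comm
      _ = ∑ i, ∑ j, ∑ l, ∑ k, G k l * (christoffel G dG k i j * u i * v j) * w l :=
          Finset.sum_congr rfl fun i _ => Finset.sum_comm
      _ = _ := by
          refine Finset.sum_congr rfl fun i _ => Finset.sum_congr rfl fun j _ =>
            Finset.sum_congr rfl fun l _ => Finset.sum_congr rfl fun k _ => by ring
  have e2 : pairing (along dG u) v w = ∑ i, ∑ j, ∑ l, dG i j l * (u i * v j * w l) := by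
    rw [pairing_along]
    simp only [pairing, Finset.mul_sum]
    exact Finset.sum_congr rfl fun i _ => Finset.sum_congr rfl fun j _ =>
            Finset.sum_congr rfl fun l _ => by ring
  have e3 : pairing (along dG v) u w = ∑ i, ∑ j, ∑ l, dG j i l * (u i * v j * w l) := by
    rw [pairing_along]
    simp only [pairing, Finset.mul_sum]
    rw [Finset.sum_comm]
    exact Finset.sum_congr rfl fun i _ => Finset.sum_congr rfl fun j _ =>
            Finset.sum_congr rfl fun l _ => by ring
  have e4 : pairing (along dG w) u v = ∑ i, ∑ j, ∑ l, dG l i j * (u i * v j * w l) := by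
    rw [pairing_along]
    simp only [pairing, Finset.mul_sum]
    rw [Finset.sum_comm]
    refine Finset.sum_congr rfl fun i _ => ?_
    rw [Finset.sum_comm]
    exact Finset.sum_congr rfl fun j _ =>
            Finset.sum_congr rfl fun l _ => by ring
  rw [e1, e2, e3, e4]
  simp only [sum_mul_christoffel hG hdet, ← Finset.sum_add_distrib, ← Finset.sum_sub_distrib,
    Finset.mul_sum]
  exact Finset.sum_congr rfl fun i _ => Finset.sum_congr rfl fun j _ =>
            Finset.sum_congr rfl fun l _ => by ring

lemma pairing_along_comm {dG : ι → Matrix ι ι ℝ} (hd : ∀ m i j, dG m i j = dG m j i)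
    (w u v : ι → ℝ) : pairing (along dG w) u v = pairing (along dG w) v u := by
  simp only [pairing_along]
  exact Finset.sum_congr rfl fun m _ => by rw [pairing_comm (hd m)]

/-- The Levi-Civita connection is compatible with the metric. -/
lemma pairing_along_eq [DecidableEq ι] {G : Matrix ι ι ℝ} (hG : ∀ i j, G i j = G j i)
    (hdet : IsUnit G.det) {dG : ι → Matrix ι ι ℝ} (hd : ∀ m i j, dG m i j = dG m j i)
    (w u v : ι → ℝ) :
    pairing (along dG w) u v = pairing G (conn (christoffel G dG) w u) v
      + pairing G u (conn (christoffel G dG) w v) := by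
  -- Of the two Koszul expansions, the derivatives in the directions `u` and `v` cancel and the two
  -- halves of the derivative in the direction `w` add up.
  rw [pairing_comm hG u, pairing_conn_christoffel hG hdet, pairing_conn_christoffel hG hdet,
    pairing_along_comm hd w v u, pairing_along_comm hd u w v, pairing_along_comm hd v w u]
  ring

/-- `G` is the matrix of an inner product. -/
structure IsMetric (G : Matrix ι ι ℝ) : Prop where
  symm : ∀ i j, G i j = G j i
  pos : ∀ u : ι → ℝ, u ≠ 0 → 0 < pairing G u u

namespace IsMetric

variable {G : Matrix ι ι ℝ}

lemma nonneg (h : IsMetric G) (u : ι → ℝ) : 0 ≤ pairing G u u := by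
  by_cases hu : u = 0
  · simp [hu, pairing_zero_left]
  · exact (h.pos u hu).le

lemma posDef (h : IsMetric G) : G.PosDef := by
  rw [Matrix.posDef_iff_dotProduct_mulVec]
  refine ⟨?_, fun u hu => ?_⟩
  · ext i j
    simp [h.symm j i]
  · have := h.pos u hu
    rw [pairing_eq_dotProduct] at this
    simpa using this

lemma isUnit_det [DecidableEq ι] (h : IsMetric G) : IsUnit G.det :=
  (Matrix.isUnit_iff_isUnit_det _).1 h.posDef.isUnit

/-- Nondegeneracy lets identities between vectors be checked through pairings, where the Koszul
formula applies. -/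
lemma eq_of_pairing_eq (h : IsMetric G) {u v : ι → ℝ}
    (huv : ∀ w, pairing G u w = pairing G v w) : u = v := by
  by_contra hne
  have := h.pos (u - v) (sub_ne_zero.2 hne)
  rw [pairing_sub_left, huv] at this
  simp at this

/-- There is a frame that is orthonormal with respect to `G`, and traces can be computed in it. -/
lemma exists_frame (h : IsMetric G) : ∃ e : ι → ι → ℝ, (∀ a, pairing G (e a) (e a) = 1) ∧
    ∀ A : Matrix ι ι ℝ, ∑ i, A i i = ∑ a, pairing G (A *ᵥ e a) (e a) := by
  classical
  -- With `G = Bᵀ B` the columns `e a` of `B⁻¹` are orthonormal, and the pairing of `A e a` with `e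
  -- a` is the `a`-th diagonal entry of `B A B⁻¹`, a matrix with the trace of `A`.
  obtain ⟨B, hB⟩ : ∃ B : Matrix ι ι ℝ, G = Bᵀ * B := by
    open scoped MatrixOrder Matrix.Norms.L2Operator in
    obtain ⟨B, hB⟩ := CStarAlgebra.nonneg_iff_eq_star_mul_self.mp h.posDef.posSemidef.nonneg
    exact ⟨B, by rwa [Matrix.star_eq_conjTranspose,
      Matrix.conjTranspose_eq_transpose_of_trivial] at hB⟩
  have hBu : IsUnit B.det := by
    have := h.isUnit_det
    rw [hB, Matrix.det_mul] at this
    exact isUnit_of_mul_isUnit_right this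
  have key : ∀ (A : Matrix ι ι ℝ) a,
      pairing G (A *ᵥ fun i => B⁻¹ i a) (fun i => B⁻¹ i a) = (B * A * B⁻¹) a a := fun A a => by
    have e1 : ∀ A : Matrix ι ι ℝ, (A *ᵥ fun i => B⁻¹ i a) = (A * B⁻¹) *ᵥ Pi.single a 1 := by
      intro A
      rw [Matrix.mulVec_single_one]
      rfl
    rw [pairing_comm h.symm, pairing_eq_dotProduct, hB, e1, Matrix.mulVec_mulVec]
    have : (Bᵀ * B) * (A * B⁻¹) = Bᵀ * (B * A * B⁻¹) := by simp only [Matrix.mul_assoc]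
    rw [this, ← Matrix.mulVec_mulVec, Matrix.dotProduct_mulVec, Matrix.vecMul_transpose, e1,
      Matrix.mul_nonsing_inv _ hBu, Matrix.one_mulVec, single_one_dotProduct,
      Matrix.mulVec_single_one]
    rfl
  refine ⟨fun a i => B⁻¹ i a, fun a => ?_, fun A => ?_⟩
  · have := key 1 a
    simpa [Matrix.mul_nonsing_inv _ hBu] using this
  · simp only [key]
    have : (B * A * B⁻¹).trace = A.trace := by
      rw [Matrix.trace_mul_comm, ← Matrix.mul_assoc, Matrix.nonsing_inv_mul _ hBu, Matrix.one_mul]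
    exact this.symm

end IsMetric

end Algebra

/-! ### Differentiation of the coordinate expressions -/

section Deriv

variable {ι : Type} [Fintype ι]

lemma hasDerivWithinAt_pairing {G : ℝ → Matrix ι ι ℝ} {G' : Matrix ι ι ℝ} {u v : ℝ → ι → ℝ}
    {u' v' : ι → ℝ} {s : Set ℝ} {r : ℝ}
    (hG : ∀ i j, HasDerivWithinAt (fun τ => G τ i j) (G' i j) s r)
    (hu : ∀ i, HasDerivWithinAt (fun τ => u τ i) (u' i) s r)
    (hv : ∀ i, HasDerivWithinAt (fun τ => v τ i) (v' i) s r) :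
    HasDerivWithinAt (fun τ => pairing (G τ) (u τ) (v τ))
      (pairing G' (u r) (v r) + pairing (G r) u' (v r) + pairing (G r) (u r) v') s r := by
  have := HasDerivWithinAt.fun_sum (u := Finset.univ) fun i _ =>
    HasDerivWithinAt.fun_sum (u := Finset.univ) fun j _ => ((hG i j).mul (hu i)).mul (hv j)
  refine this.congr_deriv ?_
  simp only [pairing, ← Finset.sum_add_distrib]
  exact Finset.sum_congr rfl fun i _ => Finset.sum_congr rfl fun j _ => by simp; ring

lemma hasDerivWithinAt_conn {Γ : ℝ → ι → ι → ι → ℝ} {Γ' : ι → ι → ι → ℝ} {u v : ℝ → ι → ℝ}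
    {u' v' : ι → ℝ} {s : Set ℝ} {r : ℝ}
    (hΓ : ∀ k i j, HasDerivWithinAt (fun τ => Γ τ k i j) (Γ' k i j) s r)
    (hu : ∀ i, HasDerivWithinAt (fun τ => u τ i) (u' i) s r)
    (hv : ∀ i, HasDerivWithinAt (fun τ => v τ i) (v' i) s r) (k : ι) :
    HasDerivWithinAt (fun τ => conn (Γ τ) (u τ) (v τ) k)
      ((conn Γ' (u r) (v r) + conn (Γ r) u' (v r) + conn (Γ r) (u r) v') k) s r :=
  hasDerivWithinAt_pairing (G := fun τ => Γ τ k) (hΓ k) hu hv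

end Deriv

/-! ### Smooth functions on space-time domains -/

section Directional

variable {E F : Type*} [NormedAddCommGroup E] [NormedSpace ℝ E] [NormedAddCommGroup F]
  [NormedSpace ℝ F] {s : Set E} {f : E → F}

lemma contDiffOn_fderivWithin_apply (hs : UniqueDiffOn ℝ s) (hf : ContDiffOn ℝ ∞ f s) (v : E) :
    ContDiffOn ℝ ∞ (fun z => fderivWithin ℝ f s z v) s :=
  (hf.fderivWithin hs (by simp)).clm_apply contDiffOn_const

/-- The second derivative stays symmetric at boundary points, because these are limits of interior
points. This is what allows mixed partial derivatives to be exchanged at the end times `0` and `T`.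
-/
lemma fderivWithin_apply_comm (hs : UniqueDiffOn ℝ s) (hcl : s ⊆ closure (interior s))
    (hf : ContDiffOn ℝ ∞ f s) (v w : E) {z : E} (hz : z ∈ s) :
    fderivWithin ℝ (fun y => fderivWithin ℝ f s y v) s z w
      = fderivWithin ℝ (fun y => fderivWithin ℝ f s y w) s z v := by
  have hd : DifferentiableWithinAt ℝ (fderivWithin ℝ f s) s z :=
    ((hf.fderivWithin hs (m := ∞) (by simp)).differentiableOn (by simp)) z hz
  have key : ∀ v w : E, fderivWithin ℝ (fun y => fderivWithin ℝ f s y v) s z w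
      = fderivWithin ℝ (fderivWithin ℝ f s) s z w v := by
    intro v w
    rw [fderivWithin_clm_apply (hs z hz) hd (differentiableWithinAt_const v)]
    simp
  rw [key, key]
  exact (hf z hz).isSymmSndFDerivWithinAt (n := ∞) (by simpa using ENat.LEInfty.out) hs (hcl hz) hz w v

lemma hasDerivWithinAt_comp_curve (hf : ContDiffOn ℝ ∞ f s) {γ : ℝ → E} {γ' : E} {τ : Set ℝ}
    {r : ℝ} (hr : γ r ∈ s) (hγ : HasDerivWithinAt γ γ' τ r) (hm : Set.MapsTo γ τ s) :
    HasDerivWithinAt (fun q => f (γ q)) (fderivWithin ℝ f s (γ r) γ') τ r :=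
  ((hf.differentiableOn (by simp) _ hr).hasFDerivWithinAt).comp_hasDerivWithinAt r hγ hm

lemma subset_closure_interior_inter {E : Type*} [TopologicalSpace E] {V : Set E} (hV : IsOpen V) {A : Set E}
    (hA : A ⊆ closure (interior A)) : V ∩ A ⊆ closure (interior (V ∩ A)) := by
  rw [interior_inter, hV.interior_eq]
  exact (Set.inter_subset_inter_right V hA).trans hV.inter_closure

end Directional

lemma Icc_subset_closure_interior {T : ℝ} (hT : 0 < T) :
    Set.Icc 0 T ⊆ closure (interior (Set.Icc 0 T)) := by
  rw [interior_Icc, closure_Ioo hT.ne]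

/-! ### Functions of `(x, t)` on relatively open subsets of `ℝ × [0, T]` -/

section Slab

/-- `W` is relatively open in `ℝ × [0, T]`. -/
def IsSlab (T : ℝ) (W : Set (ℝ × ℝ)) : Prop :=
  ∃ V : Set (ℝ × ℝ), IsOpen V ∧ W = V ∩ Set.univ ×ˢ Set.Icc 0 T

/-- `f` is smooth on `W`. -/
def SmoothOn {F : Type*} [NormedAddCommGroup F] [NormedSpace ℝ F] (W : Set (ℝ × ℝ))
    (f : ℝ → ℝ → F) : Prop :=
  ContDiffOn ℝ ∞ (fun z : ℝ × ℝ => f z.1 z.2) W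

variable {T : ℝ} {W : Set (ℝ × ℝ)} {F : Type*} [NormedAddCommGroup F] [NormedSpace ℝ F]
  {f : ℝ → ℝ → F} {x t : ℝ}

lemma IsSlab.mem_Icc (hW : IsSlab T W) (h : (x, t) ∈ W) : t ∈ Set.Icc 0 T := by
  obtain ⟨V, -, rfl⟩ := hW
  exact h.2.2

lemma IsSlab.uniqueDiffOn (hT : 0 < T) (hW : IsSlab T W) : UniqueDiffOn ℝ W := by
  obtain ⟨V, hV, rfl⟩ := hW
  rw [Set.inter_comm]
  exact (uniqueDiffOn_univ.prod (uniqueDiffOn_Icc hT)).inter hV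

lemma IsSlab.subset_closure_interior (hT : 0 < T) (hW : IsSlab T W) :
    W ⊆ closure (interior W) := by
  obtain ⟨V, hV, rfl⟩ := hW
  apply subset_closure_interior_inter hV
  rw [interior_prod_eq, closure_prod_eq]
  exact Set.prod_mono (by simp) (Icc_subset_closure_interior hT)

lemma IsSlab.eventually_x (hW : IsSlab T W) (h : (x, t) ∈ W) : ∀ᶠ x' in nhds x, (x', t) ∈ W := by
  obtain ⟨V, hV, rfl⟩ := hW
  have : Continuous fun x' : ℝ => (x', t) := by fun_prop
  filter_upwards [(hV.preimage this).mem_nhds h.1] with x' hx'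
  exact ⟨hx', trivial, h.2.2⟩

lemma IsSlab.eventually_t (hW : IsSlab T W) (h : (x, t) ∈ W) :
    ∀ᶠ t' in nhdsWithin t (Set.Icc 0 T), (x, t') ∈ W := by
  obtain ⟨V, hV, rfl⟩ := hW
  have : Continuous fun t' : ℝ => (x, t') := by fun_prop
  filter_upwards [mem_nhdsWithin_of_mem_nhds ((hV.preimage this).mem_nhds h.1),
    self_mem_nhdsWithin] with t' ht' ht
  exact ⟨ht', trivial, ht⟩

/-- The boundary of the slab matters only in the time direction: the slice of `W` at a fixed time is
a neighbourhood of `x`, so the derivative in `x` is two-sided. -/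
lemma SmoothOn.hasDerivAt_fderivWithin (hW : IsSlab T W) (hf : SmoothOn W f) (h : (x, t) ∈ W) :
    HasDerivAt (fun x' => f x' t)
      (fderivWithin ℝ (fun z : ℝ × ℝ => f z.1 z.2) W (x, t) (1, 0)) x := by
  have h1 : HasDerivWithinAt (fun x' : ℝ => (x', t)) (1, 0) {x' | (x', t) ∈ W} x :=
    ((hasDerivAt_id x).prodMk (hasDerivAt_const x t)).hasDerivWithinAt
  exact (hasDerivWithinAt_comp_curve (γ := fun x' => (x', t)) hf h h1
    fun _ hx' => hx').hasDerivAt (hW.eventually_x h)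

lemma SmoothOn.hasDerivWithinAt_fderivWithin (hW : IsSlab T W) (hf : SmoothOn W f)
    (h : (x, t) ∈ W) : HasDerivWithinAt (f x)
      (fderivWithin ℝ (fun z : ℝ × ℝ => f z.1 z.2) W (x, t) (0, 1)) (Set.Icc 0 T) t := by
  have h1 : HasDerivWithinAt (fun t' : ℝ => (x, t')) (0, 1) {t' | (x, t') ∈ W} t :=
    ((hasDerivAt_const t x).prodMk (hasDerivAt_id t)).hasDerivWithinAt
  exact (hasDerivWithinAt_comp_curve hf h h1 fun _ hx' => hx').mono_of_mem_nhdsWithin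
    (hW.eventually_t h)

lemma SmoothOn.hasDerivAt (hW : IsSlab T W) (hf : SmoothOn W f) (h : (x, t) ∈ W) :
    HasDerivAt (fun x' => f x' t) (deriv (fun x' => f x' t) x) x :=
  (hf.hasDerivAt_fderivWithin hW h).differentiableAt.hasDerivAt

lemma SmoothOn.hasDerivWithinAt (hW : IsSlab T W) (hf : SmoothOn W f)
    (h : (x, t) ∈ W) : HasDerivWithinAt (f x) (derivWithin (f x) (Set.Icc 0 T) t)
      (Set.Icc 0 T) t :=
  (hf.hasDerivWithinAt_fderivWithin hW h).differentiableWithinAt.hasDerivWithinAt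

lemma deriv_eq_fderivWithin (hW : IsSlab T W) (hf : SmoothOn W f) (h : (x, t) ∈ W) :
    deriv (fun x' => f x' t) x = fderivWithin ℝ (fun z : ℝ × ℝ => f z.1 z.2) W (x, t) (1, 0) :=
  (hf.hasDerivAt_fderivWithin hW h).deriv

lemma derivWithin_eq_fderivWithin (hT : 0 < T) (hW : IsSlab T W) (hf : SmoothOn W f)
    (h : (x, t) ∈ W) : derivWithin (f x) (Set.Icc 0 T) t
      = fderivWithin ℝ (fun z : ℝ × ℝ => f z.1 z.2) W (x, t) (0, 1) :=
  (hf.hasDerivWithinAt_fderivWithin hW h).derivWithin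
    (uniqueDiffOn_Icc hT t (hW.mem_Icc h))

lemma SmoothOn.deriv (hT : 0 < T) (hW : IsSlab T W) (hf : SmoothOn W f) :
    SmoothOn W fun x t => deriv (fun x' => f x' t) x :=
  ContDiffOn.congr (contDiffOn_fderivWithin_apply (hW.uniqueDiffOn hT) hf (1, 0))
    fun _ hz => deriv_eq_fderivWithin hW hf hz

lemma SmoothOn.derivWithin (hT : 0 < T) (hW : IsSlab T W) (hf : SmoothOn W f) :
    SmoothOn W fun x t => derivWithin (f x) (Set.Icc 0 T) t :=
  ContDiffOn.congr (contDiffOn_fderivWithin_apply (hW.uniqueDiffOn hT) hf (0, 1))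
    fun _ hz => derivWithin_eq_fderivWithin hT hW hf hz

lemma derivWithin_deriv_comm (hT : 0 < T) (hW : IsSlab T W) (hf : SmoothOn W f)
    (h : (x, t) ∈ W) :
    derivWithin (fun t' => deriv (fun x' => f x' t') x) (Set.Icc 0 T) t
      = deriv (fun x' => derivWithin (f x') (Set.Icc 0 T) t) x := by
  rw [derivWithin_eq_fderivWithin (f := fun x t => _root_.deriv (fun x' => f x' t) x) hT hW
      (hf.deriv hT hW) h,
    deriv_eq_fderivWithin (f := fun x t => _root_.derivWithin (f x) (Set.Icc 0 T) t) hW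
      (hf.derivWithin hT hW) h,
    fderivWithin_congr (fun z hz => deriv_eq_fderivWithin hW hf hz)
      (deriv_eq_fderivWithin hW hf h),
    fderivWithin_congr (fun z hz => derivWithin_eq_fderivWithin hT hW hf hz)
      (derivWithin_eq_fderivWithin hT hW hf h)]
  exact fderivWithin_apply_comm (hW.uniqueDiffOn hT) (hW.subset_closure_interior hT) hf _ _ h

end Slab

/-! ### Functions of time and space coordinates on `[0, T] × U` -/

section SpaceTime

variable {n : ℕ} {T : ℝ} {U : Set (Coord n)} {f : ℝ → Coord n → ℝ} {t : ℝ} {y : Coord n}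

/-- `f` is smooth on `[0, T] × U`. -/
def FieldSmooth (T : ℝ) (U : Set (Coord n)) (f : ℝ → Coord n → ℝ) : Prop :=
  ContDiffOn ℝ ∞ (fun q : ℝ × Coord n => f q.1 q.2) (Set.Icc 0 T ×ˢ U)

lemma fderiv_apply_eq_sum (f : Coord n → ℝ) (y v : Coord n) :
    fderiv ℝ f y v = ∑ m, v m * partialDeriv m f y := by
  have : v = ∑ m, v m • EuclideanSpace.single m (1 : ℝ) := by
    ext i
    simp [Pi.single_apply]
  conv_lhs => rw [this]
  simp [partialDeriv]

lemma uniqueDiffOn_Icc_prod (hT : 0 < T) (hU : IsOpen U) :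
    UniqueDiffOn ℝ (Set.Icc 0 T ×ˢ U) :=
  (uniqueDiffOn_Icc hT).prod hU.uniqueDiffOn

lemma Icc_prod_subset_closure_interior (hT : 0 < T) (hU : IsOpen U) :
    Set.Icc 0 T ×ˢ U ⊆ closure (interior (Set.Icc 0 T ×ˢ U)) := by
  rw [interior_prod_eq, closure_prod_eq]
  exact Set.prod_mono (Icc_subset_closure_interior hT) (by rw [hU.interior_eq]; exact subset_closure)

lemma FieldSmooth.hasFDerivAt (hU : IsOpen U) (hf : FieldSmooth T U f) (ht : t ∈ Set.Icc 0 T)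
    (hy : y ∈ U) : HasFDerivAt (f t)
      ((fderivWithin ℝ (fun q : ℝ × Coord n => f q.1 q.2) (Set.Icc 0 T ×ˢ U) (t, y)).comp
        (ContinuousLinearMap.inr ℝ ℝ (Coord n))) y := by
  have h1 : HasFDerivWithinAt (fun z : Coord n => (t, z)) (ContinuousLinearMap.inr ℝ ℝ (Coord n))
      U y := (hasFDerivAt_prodMk_right t y).hasFDerivWithinAt
  have h2 := (hf.differentiableOn (by simp) (t, y) ⟨ht, hy⟩).hasFDerivWithinAt
  exact (HasFDerivWithinAt.comp y h2 h1 fun z hz => ⟨ht, hz⟩).hasFDerivAt (hU.mem_nhds hy)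

lemma FieldSmooth.differentiableAt (hU : IsOpen U) (hf : FieldSmooth T U f)
    (ht : t ∈ Set.Icc 0 T) (hy : y ∈ U) : DifferentiableAt ℝ (f t) y :=
  (hf.hasFDerivAt hU ht hy).differentiableAt

lemma partialDeriv_eq_fderivWithin (hU : IsOpen U) (hf : FieldSmooth T U f)
    (ht : t ∈ Set.Icc 0 T) (hy : y ∈ U) (m : Fin n) : partialDeriv m (f t) y
      = fderivWithin ℝ (fun q : ℝ × Coord n => f q.1 q.2) (Set.Icc 0 T ×ˢ U) (t, y)
        (0, EuclideanSpace.single m 1) := by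
  rw [partialDeriv, (hf.hasFDerivAt hU ht hy).fderiv]
  simp

lemma FieldSmooth.hasDerivWithinAt_curve (hf : FieldSmooth T U f) (hU : IsOpen U) {γ : ℝ → Coord n}
    {γ' : Coord n} (ht : t ∈ Set.Icc 0 T) (hy : γ t ∈ U)
    (hγ : HasDerivWithinAt γ γ' (Set.Icc 0 T) t) :
    HasDerivWithinAt (fun s => f s (γ s))
      (fderivWithin ℝ (fun q : ℝ × Coord n => f q.1 q.2) (Set.Icc 0 T ×ˢ U) (t, γ t) (1, γ'))
      (Set.Icc 0 T) t := by
  have h1 : HasDerivWithinAt (fun s => (s, γ s)) (1, γ') (Set.Icc 0 T ∩ γ ⁻¹' U) t :=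
    ((hasDerivWithinAt_id t _).prodMk hγ).mono Set.inter_subset_left
  refine (hasDerivWithinAt_comp_curve (γ := fun s => (s, γ s)) hf ⟨ht, hy⟩ h1
    fun _ hr => hr).mono_of_mem_nhdsWithin ?_
  exact Filter.inter_mem self_mem_nhdsWithin (hγ.continuousWithinAt (hU.mem_nhds hy))

lemma FieldSmooth.hasDerivWithinAt (hU : IsOpen U) (hf : FieldSmooth T U f)
    (ht : t ∈ Set.Icc 0 T) (hy : y ∈ U) : HasDerivWithinAt (fun s => f s y)
      (derivWithin (fun s => f s y) (Set.Icc 0 T) t) (Set.Icc 0 T) t :=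
  (hf.hasDerivWithinAt_curve hU (γ := fun _ => y) ht hy
    (hasDerivWithinAt_const t _ y)).differentiableWithinAt.hasDerivWithinAt

lemma derivWithin_eq_fderivWithin_field (hT : 0 < T) (hU : IsOpen U) (hf : FieldSmooth T U f)
    (ht : t ∈ Set.Icc 0 T) (hy : y ∈ U) : derivWithin (fun s => f s y) (Set.Icc 0 T) t
      = fderivWithin ℝ (fun q : ℝ × Coord n => f q.1 q.2) (Set.Icc 0 T ×ˢ U) (t, y) (1, 0) :=
  (hf.hasDerivWithinAt_curve hU (γ := fun _ => y) ht hy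
    (hasDerivWithinAt_const t _ y)).derivWithin (uniqueDiffOn_Icc hT t ht)

lemma FieldSmooth.partialDeriv (hT : 0 < T) (hU : IsOpen U) (hf : FieldSmooth T U f) (m : Fin n) :
    FieldSmooth T U fun t y => partialDeriv m (f t) y :=
  ContDiffOn.congr (contDiffOn_fderivWithin_apply (uniqueDiffOn_Icc_prod hT hU) hf
    (0, EuclideanSpace.single m 1))
    fun _ hz => partialDeriv_eq_fderivWithin hU hf hz.1 hz.2 m

lemma FieldSmooth.derivWithin (hT : 0 < T) (hU : IsOpen U) (hf : FieldSmooth T U f) :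
    FieldSmooth T U fun t y => derivWithin (fun s => f s y) (Set.Icc 0 T) t :=
  ContDiffOn.congr (contDiffOn_fderivWithin_apply (uniqueDiffOn_Icc_prod hT hU) hf (1, 0))
    fun _ hz => derivWithin_eq_fderivWithin_field hT hU hf hz.1 hz.2

lemma derivWithin_partialDeriv_comm (hT : 0 < T) (hU : IsOpen U) (hf : FieldSmooth T U f)
    (ht : t ∈ Set.Icc 0 T) (hy : y ∈ U) (m : Fin n) :
    derivWithin (fun s => partialDeriv m (f s) y) (Set.Icc 0 T) t
      = partialDeriv m (fun z => derivWithin (fun s => f s z) (Set.Icc 0 T) t) y := by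
  rw [derivWithin_eq_fderivWithin_field hT hU (hf.partialDeriv hT hU m) ht hy,
    partialDeriv_eq_fderivWithin hU (hf.derivWithin hT hU) ht hy m,
    fderivWithin_congr (f₁ := fun q : ℝ × Coord n => CurveShrinking.partialDeriv m (f q.1) q.2)
      (fun z hz => partialDeriv_eq_fderivWithin hU hf hz.1 hz.2 m)
      (partialDeriv_eq_fderivWithin hU hf ht hy m),
    fderivWithin_congr
      (f₁ := fun q : ℝ × Coord n => _root_.derivWithin (fun s => f s q.2) (Set.Icc 0 T) q.1)
      (fun z hz => derivWithin_eq_fderivWithin_field hT hU hf hz.1 hz.2)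
      (derivWithin_eq_fderivWithin_field hT hU hf ht hy)]
  exact fderivWithin_apply_comm (uniqueDiffOn_Icc_prod hT hU)
    (Icc_prod_subset_closure_interior hT hU) hf _ _ ⟨ht, hy⟩

lemma hasDerivWithinAt_coord {γ : ℝ → Coord n} {γ' : Fin n → ℝ} {s : Set ℝ} {r : ℝ}
    (hγ : ∀ i, HasDerivWithinAt (fun q => γ q i) (γ' i) s r) :
    HasDerivWithinAt γ (WithLp.toLp 2 γ') s r := by
  exact (PiLp.continuousLinearEquiv 2 ℝ fun _ : Fin n => ℝ).symm.hasFDerivAt.comp_hasDerivWithinAt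
    r (hasDerivWithinAt_pi.2 hγ)

/-- The chain rule along a curve in space. -/
lemma hasDerivWithinAt_comp_space {f : Coord n → ℝ} {γ : ℝ → Coord n} {γ' : Fin n → ℝ} {s : Set ℝ}
    {r : ℝ} (hf : DifferentiableAt ℝ f (γ r))
    (hγ : ∀ i, HasDerivWithinAt (fun q => γ q i) (γ' i) s r) :
    HasDerivWithinAt (fun q => f (γ q)) (∑ m, γ' m * partialDeriv m f (γ r)) s r := by
  have := hf.hasFDerivAt.comp_hasDerivWithinAt r (hasDerivWithinAt_coord hγ)
  rw [fderiv_apply_eq_sum] at this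
  exact this

/-- The chain rule along a curve in space-time. -/
lemma FieldSmooth.hasDerivWithinAt_comp (hT : 0 < T) (hf : FieldSmooth T U f) (hU : IsOpen U)
    {γ : ℝ → Coord n} {γ' : Fin n → ℝ} (ht : t ∈ Set.Icc 0 T) (hy : γ t ∈ U)
    (hγ : ∀ i, HasDerivWithinAt (fun q => γ q i) (γ' i) (Set.Icc 0 T) t) :
    HasDerivWithinAt (fun s => f s (γ s))
      (_root_.derivWithin (fun s => f s (γ t)) (Set.Icc 0 T) t
        + ∑ m, γ' m * CurveShrinking.partialDeriv m (f t) (γ t)) (Set.Icc 0 T) t := by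
  refine (hf.hasDerivWithinAt_curve hU ht hy (hasDerivWithinAt_coord hγ)).congr_deriv ?_
  -- The derivative in the direction `(1, γ')` splits by linearity into the directions `(1, 0)` and
  -- `(0, γ')`.
  have h1 := fderiv_apply_eq_sum (f t) (γ t) (WithLp.toLp 2 γ')
  rw [(hf.hasFDerivAt hU ht hy).fderiv] at h1
  rw [derivWithin_eq_fderivWithin_field hT hU hf ht hy, ← h1]
  simp only [ContinuousLinearMap.comp_apply, ContinuousLinearMap.inr_apply, ← map_add]
  simp

lemma FieldSmooth.comp_curve {W : Set (ℝ × ℝ)} (hW : IsSlab T W) (hf : FieldSmooth T U f)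
    {γ : ℝ → ℝ → Coord n} (hγ : SmoothOn W γ) (hm : ∀ x t, (x, t) ∈ W → γ x t ∈ U) :
    SmoothOn W fun x t => f t (γ x t) :=
  ContDiffOn.comp (g := fun q : ℝ × Coord n => f q.1 q.2) (f := fun z : ℝ × ℝ => (z.2, γ z.1 z.2))
    hf (contDiff_snd.contDiffOn.prodMk hγ) fun z hz => ⟨hW.mem_Icc hz, hm z.1 z.2 hz⟩

end SpaceTime

/-! ### Time-dependent metrics in coordinates -/

section Smoothness

variable {n : ℕ} {T : ℝ} {U : Set (Coord n)}

namespace FieldSmooth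

variable {f f' : ℝ → Coord n → ℝ}

lemma const (r : ℝ) : FieldSmooth T U fun _ _ => r := contDiffOn_const

lemma add (hf : FieldSmooth T U f) (hf' : FieldSmooth T U f') :
    FieldSmooth T U fun t y => f t y + f' t y := ContDiffOn.add hf hf'

lemma sub (hf : FieldSmooth T U f) (hf' : FieldSmooth T U f') :
    FieldSmooth T U fun t y => f t y - f' t y := ContDiffOn.sub hf hf'

lemma mul (hf : FieldSmooth T U f) (hf' : FieldSmooth T U f') :
    FieldSmooth T U fun t y => f t y * f' t y := ContDiffOn.mul hf hf'

lemma sum {κ : Type*} [Fintype κ] {f : κ → ℝ → Coord n → ℝ} (hf : ∀ a, FieldSmooth T U (f a)) :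
    FieldSmooth T U fun t y => ∑ a, f a t y := ContDiffOn.sum fun a _ => hf a

lemma prod {κ : Type*} [Fintype κ] {f : κ → ℝ → Coord n → ℝ} (hf : ∀ a, FieldSmooth T U (f a)) :
    FieldSmooth T U fun t y => ∏ a, f a t y := contDiffOn_prod fun a _ => hf a

lemma det {κ : Type*} [Fintype κ] [DecidableEq κ] {M : ℝ → Coord n → Matrix κ κ ℝ}
    (hM : ∀ a b, FieldSmooth T U fun t y => M t y a b) :
    FieldSmooth T U fun t y => (M t y).det := by
  simp only [Matrix.det_apply']
  exact sum fun σ => (const _).mul (prod fun i => hM _ _)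

/-- Cramer's rule: an entry of the adjugate is the determinant of a matrix in which one row has been
replaced by a constant unit vector, so it is smooth, and the determinant does not vanish. -/
lemma nonsing_inv {κ : Type*} [Fintype κ] [DecidableEq κ] {M : ℝ → Coord n → Matrix κ κ ℝ}
    (hM : ∀ a b, FieldSmooth T U fun t y => M t y a b)
    (hdet : ∀ t ∈ Set.Icc 0 T, ∀ y ∈ U, (M t y).det ≠ 0) (a b : κ) :
    FieldSmooth T U fun t y => (M t y)⁻¹ a b := by
  simp only [Matrix.inv_def, Ring.inverse_eq_inv', Matrix.smul_apply, smul_eq_mul,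
    Matrix.adjugate_apply]
  refine FieldSmooth.mul (ContDiffOn.inv (det hM) fun z hz => hdet z.1 hz.1 z.2 hz.2) (det ?_)
  intro i j
  by_cases hi : i = b
  · subst hi
    simpa using const _
  · simpa [Matrix.updateRow_ne hi] using hM i j

end FieldSmooth

end Smoothness

/-! ### Curvature and the Ricci flow equation in coordinates -/

section LocalMetric

variable {n : ℕ}

/-- The partial derivatives `∂ₘ gᵢⱼ`. -/
def metricDeriv (G : Coord n → Matrix (Fin n) (Fin n) ℝ) (y : Coord n) (m : Fin n) :
    Matrix (Fin n) (Fin n) ℝ :=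
  Matrix.of fun a b => partialDeriv m (fun z => G z a b) y

/-- The partial derivatives `∂ₘ Γᵏᵢⱼ`. -/
def christoffelDeriv (G : Coord n → Matrix (Fin n) (Fin n) ℝ) (y : Coord n) (m : Fin n) :
    Fin n → Fin n → Fin n → ℝ :=
  fun k i j => partialDeriv m (fun z => localChristoffel G z k i j) y

/-- The Ricci tensor as a matrix. -/
def ricci (G : Coord n → Matrix (Fin n) (Fin n) ℝ) (y : Coord n) : Matrix (Fin n) (Fin n) ℝ :=
  Matrix.of (localRic G y)

/-- The matrices `∇ₘ Ric`. -/
def covRicci (G : Coord n → Matrix (Fin n) (Fin n) ℝ) (y : Coord n) (m : Fin n) :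
    Matrix (Fin n) (Fin n) ℝ :=
  Matrix.of fun j k => ∑ i, localCovRiem G y m i j k i

/-- The vector `R(u, v) w`. -/
def riemApply (G : Coord n → Matrix (Fin n) (Fin n) ℝ) (y : Coord n) (u v w : Fin n → ℝ) :
    Fin n → ℝ :=
  fun l => ∑ i, ∑ j, ∑ k, localRiem G y i j k l * u i * v j * w k

/-- The derivatives `∂ₜ Γᵏᵢⱼ` in `[0, T]`. -/
def christoffelDot (T : ℝ) (G : ℝ → Coord n → Matrix (Fin n) (Fin n) ℝ) (t : ℝ) (y : Coord n) :
    Fin n → Fin n → Fin n → ℝ :=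
  fun k i j => derivWithin (fun s => localChristoffel (G s) y k i j) (Set.Icc 0 T) t

/-- This index-free form of the curvature is the one that appears when the two orders of covariant
differentiation are subtracted in `IsFlow.covT_covX`. -/
lemma riemApply_eq (G : Coord n → Matrix (Fin n) (Fin n) ℝ) (y : Coord n) (u v w : Fin n → ℝ) :
    riemApply G y u v w = conn (along (christoffelDeriv G y) u) v w
      - conn (along (christoffelDeriv G y) v) u w
      + conn (localChristoffel G y) u (conn (localChristoffel G y) v w)
      - conn (localChristoffel G y) v (conn (localChristoffel G y) u w) := by
  have e0 : ∀ (w : Fin n → ℝ) k i j, along (christoffelDeriv G y) w k i j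
      = ∑ m, w m * christoffelDeriv G y m k i j := by
    intro w k i j
    simp [along, Finset.sum_apply]
  funext l
  have e1 : conn (along (christoffelDeriv G y) u) v w l
      = ∑ i, ∑ j, ∑ k, christoffelDeriv G y i l j k * u i * v j * w k := by
    simp only [conn, e0, Finset.sum_mul]
    rw [Finset.sum_comm' (t' := Finset.univ) (s' := fun _ => Finset.univ) (by simp)]
    calc _ = ∑ k, ∑ i, ∑ j, u i * christoffelDeriv G y i l j k * v j * w k :=
          Finset.sum_congr rfl fun _ _ => Finset.sum_comm
      _ = ∑ i, ∑ k, ∑ j, u i * christoffelDeriv G y i l j k * v j * w k := Finset.sum_comm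
      _ = ∑ i, ∑ j, ∑ k, u i * christoffelDeriv G y i l j k * v j * w k :=
          Finset.sum_congr rfl fun _ _ => Finset.sum_comm
      _ = _ := Finset.sum_congr rfl fun _ _ => Finset.sum_congr rfl fun _ _ =>
          Finset.sum_congr rfl fun _ _ => by ring
  have e2 : conn (along (christoffelDeriv G y) v) u w l
      = ∑ i, ∑ j, ∑ k, christoffelDeriv G y j l i k * u i * v j * w k := by
    simp only [conn, e0, Finset.sum_mul]
    refine Finset.sum_congr rfl fun i _ => ?_
    rw [Finset.sum_comm]
    exact Finset.sum_congr rfl fun _ _ => Finset.sum_congr rfl fun _ _ => by ring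
  have e3 : ∀ (Γ : Fin n → Fin n → Fin n → ℝ) (u v : Fin n → ℝ), conn Γ u (conn Γ v w) l
      = ∑ i, ∑ j, ∑ k, (∑ m, Γ l i m * Γ m j k) * u i * v j * w k := by
    intro Γ u v
    simp only [conn, Finset.mul_sum, Finset.sum_mul]
    refine Finset.sum_congr rfl fun i _ => ?_
    rw [Finset.sum_comm]
    refine Finset.sum_congr rfl fun j _ => ?_
    rw [Finset.sum_comm]
    exact Finset.sum_congr rfl fun _ _ => Finset.sum_congr rfl fun _ _ => by ring
  have e4 : conn (localChristoffel G y) v (conn (localChristoffel G y) u w) l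
      = ∑ i, ∑ j, ∑ k, (∑ m, localChristoffel G y l j m * localChristoffel G y m i k)
        * u i * v j * w k := by
    rw [e3, Finset.sum_comm]
    exact Finset.sum_congr rfl fun _ _ => Finset.sum_congr rfl fun _ _ =>
      Finset.sum_congr rfl fun _ _ => by ring
  simp only [Pi.sub_apply, Pi.add_apply, e1, e2, e4, e3 _ u v]
  simp only [riemApply, ← Finset.sum_add_distrib, ← Finset.sum_sub_distrib]
  refine Finset.sum_congr rfl fun i _ => Finset.sum_congr rfl fun j _ =>
      Finset.sum_congr rfl fun k _ => ?_
  simp only [localRiem, christoffelDeriv, Finset.sum_sub_distrib]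
  ring

lemma localRm_eq (G : Coord n → Matrix (Fin n) (Fin n) ℝ) (y : Coord n) (u v w z : Fin n → ℝ) :
    localRm G y u v w z = pairing (G y) (riemApply G y u v w) z := rfl

/-- The metric matrices `G t y` form a smooth family of Riemannian metrics on `[0, T] × U`. -/
structure LocalMetric (T : ℝ) (U : Set (Coord n)) (G : ℝ → Coord n → Matrix (Fin n) (Fin n) ℝ) :
    Prop where
  pos_time : 0 < T
  isOpen : IsOpen U
  smooth : ∀ i j, FieldSmooth T U fun t y => G t y i j
  symm : ∀ t y i j, G t y i j = G t y j i
  isMetric : ∀ t ∈ Set.Icc 0 T, ∀ y ∈ U, IsMetric (G t y)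

/-- A Ricci flow in coordinates. -/
structure LocalRicciFlow (T : ℝ) (U : Set (Coord n))
    (G : ℝ → Coord n → Matrix (Fin n) (Fin n) ℝ) : Prop extends LocalMetric T U G where
  evolution : ∀ t ∈ Set.Icc 0 T, ∀ y ∈ U, ∀ i j,
    HasDerivWithinAt (fun s => G s y i j) (-2 * localRic (G t) y i j) (Set.Icc 0 T) t

variable {T : ℝ} {U : Set (Coord n)} {G : ℝ → Coord n → Matrix (Fin n) (Fin n) ℝ}

namespace LocalMetric

lemma metricDeriv_symm (h : LocalMetric T U G) (t : ℝ) (y : Coord n) (m i j : Fin n) :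
    metricDeriv (G t) y m i j = metricDeriv (G t) y m j i := by
  simp only [metricDeriv, Matrix.of_apply, h.symm t _ i j]

lemma christoffel_symm (h : LocalMetric T U G) (t : ℝ) (y : Coord n) (k i j : Fin n) :
    localChristoffel (G t) y k i j = localChristoffel (G t) y k j i :=
  christoffel_comm _ _ (h.metricDeriv_symm t y) k i j

lemma smooth_inv (h : LocalMetric T U G) (i j : Fin n) :
    FieldSmooth T U fun t y => (G t y)⁻¹ i j :=
  FieldSmooth.nonsing_inv h.smooth (fun t ht y hy => (h.isMetric t ht y hy).isUnit_det.ne_zero) i j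

lemma smooth_metricDeriv (h : LocalMetric T U G) (m i j : Fin n) :
    FieldSmooth T U fun t y => metricDeriv (G t) y m i j :=
  (h.smooth i j).partialDeriv h.pos_time h.isOpen m

lemma smooth_christoffel (h : LocalMetric T U G) (k i j : Fin n) :
    FieldSmooth T U fun t y => localChristoffel (G t) y k i j :=
  (FieldSmooth.const _).mul <| FieldSmooth.sum fun l => (h.smooth_inv k l).mul <|
    ((h.smooth_metricDeriv i j l).add (h.smooth_metricDeriv j i l)).sub (h.smooth_metricDeriv l i j)

lemma smooth_christoffelDeriv (h : LocalMetric T U G) (m k i j : Fin n) :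
    FieldSmooth T U fun t y => christoffelDeriv (G t) y m k i j :=
  (h.smooth_christoffel k i j).partialDeriv h.pos_time h.isOpen m

lemma smooth_riem (h : LocalMetric T U G) (i j k l : Fin n) :
    FieldSmooth T U fun t y => localRiem (G t) y i j k l :=
  ((h.smooth_christoffelDeriv i l j k).sub (h.smooth_christoffelDeriv j l i k)).add <|
    FieldSmooth.sum fun m => ((h.smooth_christoffel l i m).mul (h.smooth_christoffel m j k)).sub
      ((h.smooth_christoffel l j m).mul (h.smooth_christoffel m i k))

lemma smooth_ricci (h : LocalMetric T U G) (j k : Fin n) :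
    FieldSmooth T U fun t y => localRic (G t) y j k :=
  FieldSmooth.sum fun i => h.smooth_riem i j k i

lemma smooth_covRiem (h : LocalMetric T U G) (m i j k l : Fin n) :
    FieldSmooth T U fun t y => localCovRiem (G t) y m i j k l :=
  ((h.smooth_riem i j k l).partialDeriv h.pos_time h.isOpen m).add <|
    FieldSmooth.sum fun a =>
      ((((h.smooth_christoffel l m a).mul (h.smooth_riem i j k a)).sub
        ((h.smooth_christoffel a m i).mul (h.smooth_riem a j k l))).sub
        ((h.smooth_christoffel a m j).mul (h.smooth_riem i a k l))).sub
        ((h.smooth_christoffel a m k).mul (h.smooth_riem i j a l))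

/-- The Koszul formula for the local metric. -/
lemma koszul (h : LocalMetric T U G) {t : ℝ} (ht : t ∈ Set.Icc 0 T) {y : Coord n} (hy : y ∈ U)
    (u v w : Fin n → ℝ) :
    pairing (G t y) (conn (localChristoffel (G t) y) u v) w
      = (1 / 2) * (pairing (along (metricDeriv (G t) y) u) v w
        + pairing (along (metricDeriv (G t) y) v) u w
        - pairing (along (metricDeriv (G t) y) w) u v) :=
  pairing_conn_christoffel (h.symm t y) (h.isMetric t ht y hy).isUnit_det _ u v w

lemma compatible (h : LocalMetric T U G) {t : ℝ} (ht : t ∈ Set.Icc 0 T) {y : Coord n} (hy : y ∈ U)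
    (w u v : Fin n → ℝ) :
    pairing (along (metricDeriv (G t) y) w) u v
      = pairing (G t y) (conn (localChristoffel (G t) y) w u) v
        + pairing (G t y) u (conn (localChristoffel (G t) y) w v) :=
  pairing_along_eq (h.symm t y) (h.isMetric t ht y hy).isUnit_det (h.metricDeriv_symm t y) w u v

/-- Contraction commutes with covariant differentiation: the Christoffel terms belonging to the
contracted upper and lower index cancel (`e2`). -/
lemma covRicci_eq (h : LocalMetric T U G) {t : ℝ} (ht : t ∈ Set.Icc 0 T) {y : Coord n}
    (hy : y ∈ U) (m j k : Fin n) :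
    covRicci (G t) y m j k = partialDeriv m (fun z => localRic (G t) z j k) y
      - ∑ a, localChristoffel (G t) y a m j * localRic (G t) y a k
      - ∑ a, localChristoffel (G t) y a m k * localRic (G t) y j a := by
  have e1 : partialDeriv m (fun z => localRic (G t) z j k) y
      = ∑ i, partialDeriv m (fun z => localRiem (G t) z i j k i) y := by
    simp only [partialDeriv, localRic]
    rw [fderiv_fun_sum fun i _ => (h.smooth_riem i j k i).differentiableAt h.isOpen ht hy]
    simp
  have e2 : ∑ i, ∑ a, localChristoffel (G t) y i m a * localRiem (G t) y i j k a
      = ∑ i, ∑ a, localChristoffel (G t) y a m i * localRiem (G t) y a j k i := Finset.sum_comm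
  have e3 : ∑ a, localChristoffel (G t) y a m j * localRic (G t) y a k
      = ∑ i, ∑ a, localChristoffel (G t) y a m j * localRiem (G t) y i a k i := by
    simp only [localRic, Finset.mul_sum]
    exact Finset.sum_comm
  have e4 : ∑ a, localChristoffel (G t) y a m k * localRic (G t) y j a
      = ∑ i, ∑ a, localChristoffel (G t) y a m k * localRiem (G t) y i j a i := by
    simp only [localRic, Finset.mul_sum]
    exact Finset.sum_comm
  simp only [covRicci, Matrix.of_apply, localCovRiem, e1, e3, e4, Finset.sum_add_distrib,
    Finset.sum_sub_distrib, e2]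
  ring

end LocalMetric

/-- The partial derivatives `∂ₘ Ricᵢⱼ`. -/
def ricciDeriv (G : Coord n → Matrix (Fin n) (Fin n) ℝ) (y : Coord n) (m : Fin n) :
    Matrix (Fin n) (Fin n) ℝ :=
  Matrix.of fun a b => partialDeriv m (fun z => localRic G z a b) y

/-- It serves to absorb the Christoffel terms left over when the Koszul formula is differentiated in
time. -/
lemma LocalMetric.pairing_covRicci (h : LocalMetric T U G) {t : ℝ} (ht : t ∈ Set.Icc 0 T)
    {y : Coord n} (hy : y ∈ U) (u v w : Fin n → ℝ) :
    pairing (along (covRicci (G t) y) u) v w = pairing (along (ricciDeriv (G t) y) u) v w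
      - pairing (ricci (G t) y) (conn (localChristoffel (G t) y) u v) w
      - pairing (ricci (G t) y) v (conn (localChristoffel (G t) y) u w) := by
  have e1 : pairing (ricci (G t) y) (conn (localChristoffel (G t) y) u v) w
      = ∑ m, ∑ j, ∑ k, (∑ a, localChristoffel (G t) y a m j * localRic (G t) y a k)
        * u m * v j * w k := by
    simp only [pairing, conn, ricci, Matrix.of_apply, Finset.mul_sum, Finset.sum_mul]
    calc _ = ∑ k, ∑ a, ∑ m, ∑ j, localRic (G t) y a k
              * (localChristoffel (G t) y a m j * u m * v j) * w k := Finset.sum_comm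
      _ = ∑ k, ∑ m, ∑ a, ∑ j, localRic (G t) y a k
              * (localChristoffel (G t) y a m j * u m * v j) * w k :=
          Finset.sum_congr rfl fun _ _ => Finset.sum_comm
      _ = ∑ m, ∑ k, ∑ a, ∑ j, localRic (G t) y a k
              * (localChristoffel (G t) y a m j * u m * v j) * w k := Finset.sum_comm
      _ = ∑ m, ∑ k, ∑ j, ∑ a, localRic (G t) y a k
              * (localChristoffel (G t) y a m j * u m * v j) * w k :=
          Finset.sum_congr rfl fun _ _ => Finset.sum_congr rfl fun _ _ => Finset.sum_comm
      _ = ∑ m, ∑ j, ∑ k, ∑ a, localRic (G t) y a k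
              * (localChristoffel (G t) y a m j * u m * v j) * w k :=
          Finset.sum_congr rfl fun _ _ => Finset.sum_comm
      _ = _ := Finset.sum_congr rfl fun _ _ => Finset.sum_congr rfl fun _ _ =>
          Finset.sum_congr rfl fun _ _ => Finset.sum_congr rfl fun _ _ => by ring
  have e2 : pairing (ricci (G t) y) v (conn (localChristoffel (G t) y) u w)
      = ∑ m, ∑ j, ∑ k, (∑ a, localChristoffel (G t) y a m k * localRic (G t) y j a)
        * u m * v j * w k := by
    simp only [pairing, conn, ricci, Matrix.of_apply, Finset.mul_sum, Finset.sum_mul]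
    calc _ = ∑ j, ∑ m, ∑ a, ∑ k, localRic (G t) y j a * v j
              * (localChristoffel (G t) y a m k * u m * w k) :=
          Finset.sum_congr rfl fun _ _ => Finset.sum_comm
      _ = ∑ m, ∑ j, ∑ a, ∑ k, localRic (G t) y j a * v j
              * (localChristoffel (G t) y a m k * u m * w k) := Finset.sum_comm
      _ = ∑ m, ∑ j, ∑ k, ∑ a, localRic (G t) y j a * v j
              * (localChristoffel (G t) y a m k * u m * w k) :=
          Finset.sum_congr rfl fun _ _ => Finset.sum_congr rfl fun _ _ => Finset.sum_comm
      _ = _ := Finset.sum_congr rfl fun _ _ => Finset.sum_congr rfl fun _ _ =>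
          Finset.sum_congr rfl fun _ _ => Finset.sum_congr rfl fun _ _ => by ring
  rw [e1, e2, pairing_along, pairing_along]
  simp only [pairing, Finset.mul_sum, ← Finset.sum_sub_distrib]
  refine Finset.sum_congr rfl fun m _ => Finset.sum_congr rfl fun j _ =>
          Finset.sum_congr rfl fun k _ => ?_
  rw [h.covRicci_eq ht hy]
  simp only [ricciDeriv, Matrix.of_apply]
  ring

namespace LocalRicciFlow

/-- No curvature identity is needed: `-2 Ric` is the time derivative of a symmetric matrix. -/
lemma ricci_symm (h : LocalRicciFlow T U G) {t : ℝ} (ht : t ∈ Set.Icc 0 T) {y : Coord n}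
    (hy : y ∈ U) (i j : Fin n) : ricci (G t) y i j = ricci (G t) y j i := by
  have h1 := h.evolution t ht y hy i j
  simp only [h.symm _ y i j] at h1
  have := (uniqueDiffOn_Icc h.pos_time t ht).eq_deriv _ h1 (h.evolution t ht y hy j i)
  simpa [ricci] using this

lemma derivWithin_eq (h : LocalRicciFlow T U G) {t : ℝ} (ht : t ∈ Set.Icc 0 T) {y : Coord n}
    (hy : y ∈ U) (i j : Fin n) :
    derivWithin (fun s => G s y i j) (Set.Icc 0 T) t = -2 * localRic (G t) y i j :=
  (h.evolution t ht y hy i j).derivWithin (uniqueDiffOn_Icc h.pos_time t ht)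

/-- Time and space derivatives of the metric are exchanged, and the flow equation, valid in a whole
neighbourhood of `y`, is then differentiated in space. -/
lemma hasDerivWithinAt_metricDeriv (h : LocalRicciFlow T U G) {t : ℝ} (ht : t ∈ Set.Icc 0 T)
    {y : Coord n} (hy : y ∈ U) (m i j : Fin n) :
    HasDerivWithinAt (fun s => metricDeriv (G s) y m i j) (-2 * ricciDeriv (G t) y m i j)
      (Set.Icc 0 T) t := by
  refine ((h.smooth_metricDeriv m i j).hasDerivWithinAt h.isOpen ht hy).congr_deriv ?_
  refine (derivWithin_partialDeriv_comm h.pos_time h.isOpen (h.smooth i j) ht hy m).trans ?_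
  have : (fun z => derivWithin (fun s => G s z i j) (Set.Icc 0 T) t) =ᶠ[nhds y]
      fun z => -2 * localRic (G t) z i j := by
    filter_upwards [h.isOpen.mem_nhds hy] with z hz
    exact h.derivWithin_eq ht hz i j
  simp only [partialDeriv, ricciDeriv, Matrix.of_apply]
  rw [this.fderiv_eq, fderiv_const_mul
    ((h.smooth_ricci i j).differentiableAt h.isOpen ht hy)]
  simp

lemma hasDerivWithinAt_christoffel (h : LocalRicciFlow T U G) {t : ℝ} (ht : t ∈ Set.Icc 0 T)
    {y : Coord n} (hy : y ∈ U) (k i j : Fin n) :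
    HasDerivWithinAt (fun s => localChristoffel (G s) y k i j) (christoffelDot T G t y k i j)
      (Set.Icc 0 T) t :=
  (h.smooth_christoffel k i j).hasDerivWithinAt h.isOpen ht hy

/-- The evolution of the Christoffel symbols under the Ricci flow. -/
lemma pairing_christoffelDot (h : LocalRicciFlow T U G) {t : ℝ} (ht : t ∈ Set.Icc 0 T)
    {y : Coord n} (hy : y ∈ U) (u v w : Fin n → ℝ) :
    pairing (G t y) (conn (christoffelDot T G t y) u v) w
      = -(pairing (along (covRicci (G t) y) u) v w + pairing (along (covRicci (G t) y) v) u w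
        - pairing (along (covRicci (G t) y) w) u v) := by
  have hc : ∀ (u : Fin n → ℝ) i, HasDerivWithinAt (fun _ : ℝ => u i) ((0 : Fin n → ℝ) i)
      (Set.Icc 0 T) t := fun u i => hasDerivWithinAt_const t _ _
  -- Both sides of the Koszul formula are differentiated in time with `u`, `v`, `w` frozen. On the
  -- left the moving metric contributes `-2 Ric(Γ(u, v), w)`, which is exactly what turns the
  -- partial derivatives of `Ric` on the right into covariant ones.
  have hl := hasDerivWithinAt_pairing (G' := (-2 : ℝ) • ricci (G t) y) (h.evolution t ht y hy)
    (fun k => hasDerivWithinAt_conn (h.hasDerivWithinAt_christoffel ht hy) (hc u) (hc v) k) (hc w)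
  have ha : ∀ u v w : Fin n → ℝ, HasDerivWithinAt
      (fun s => pairing (along (metricDeriv (G s) y) u) v w)
      (-2 * pairing (along (ricciDeriv (G t) y) u) v w) (Set.Icc 0 T) t := by
    intro u v w
    have e : ∀ i j, HasDerivWithinAt (fun s => along (metricDeriv (G s) y) u i j)
        (((-2 : ℝ) • along (ricciDeriv (G t) y) u) i j) (Set.Icc 0 T) t := by
      intro i j
      simp only [along, Matrix.sum_apply, Matrix.smul_apply, smul_eq_mul]
      refine (HasDerivWithinAt.fun_sum fun m _ =>
        (h.hasDerivWithinAt_metricDeriv ht hy m i j).const_mul (u m)).congr_deriv ?_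
      rw [Finset.mul_sum]
      exact Finset.sum_congr rfl fun m _ => by ring
    refine (hasDerivWithinAt_pairing e (hc v) (hc w)).congr_deriv ?_
    rw [pairing_smul_matrix, pairing_zero_left, pairing_zero_right, add_zero, add_zero]
  have hr := ((((ha u v w).add (ha v u w)).sub (ha w u v)).const_mul (1 / 2 : ℝ))
  have hl' := hl.congr (fun s hs => (h.koszul hs hy u v w).symm) (h.koszul ht hy u v w).symm
  have := (uniqueDiffOn_Icc h.pos_time t ht).eq_deriv _ hl' hr
  simp only [pairing_smul_matrix, conn_zero_left, conn_zero_right, add_zero,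
    pairing_zero_right] at this
  rw [h.pairing_covRicci ht hy, h.pairing_covRicci ht hy, h.pairing_covRicci ht hy,
    conn_comm (h.christoffel_symm t y) v u, conn_comm (h.christoffel_symm t y) w u,
    conn_comm (h.christoffel_symm t y) w v,
    pairing_comm (h.ricci_symm ht hy) v (conn (localChristoffel (G t) y) u w)]
  linarith

end LocalRicciFlow

/-! ### Bounds by the curvature -/

/-- The curvature tensor of `G` at `y` and its first covariant derivative are bounded by `K`. -/
def CurvatureBoundAt (G : Coord n → Matrix (Fin n) (Fin n) ℝ) (y : Coord n) (K : ℝ) : Prop :=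
  ∀ a u v w z : Fin n → ℝ, (∀ b ∈ [a, u, v, w, z], pairing (G y) b b = 1) →
    |localRm G y u v w z| ≤ K ∧ |localCovRm G y a u v w z| ≤ K

variable {G : Coord n → Matrix (Fin n) (Fin n) ℝ} {y : Coord n} {K : ℝ}

lemma CurvatureBoundAt.ricci_le (hK : CurvatureBoundAt G y K) (hG : IsMetric (G y))
    {v w : Fin n → ℝ} (hv : pairing (G y) v v = 1) (hw : pairing (G y) w w = 1) :
    |pairing (ricci G y) v w| ≤ n * K := by
  obtain ⟨e, he, htr⟩ := hG.exists_frame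
  have h1 : pairing (ricci G y) v w = ∑ a, localRm G y (e a) v w (e a) := by
    -- `Ric(v, w)` is the trace of the endomorphism `u ↦ R(u, v) w`, whose matrix this is; in an
    -- orthonormal frame it is a sum of `n` terms, each at most `K` in absolute value.
    have := htr (Matrix.of fun l i => ∑ j, ∑ k, localRiem G y i j k l * v j * w k)
    have e1 : pairing (ricci G y) v w = ∑ i, ∑ j, ∑ k, localRiem G y i j k i * v j * w k := by
      simp only [pairing, ricci, localRic, Matrix.of_apply, Finset.sum_mul]
      calc _ = ∑ j, ∑ i, ∑ k, localRiem G y i j k i * v j * w k :=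
            Finset.sum_congr rfl fun _ _ => Finset.sum_comm
        _ = _ := Finset.sum_comm
    rw [e1]
    refine this.trans (Finset.sum_congr rfl fun a _ => ?_)
    rw [localRm_eq]
    congr 1
    funext l
    simp only [Matrix.mulVec, dotProduct, Matrix.of_apply, riemApply, Finset.sum_mul]
    exact Finset.sum_congr rfl fun _ _ => Finset.sum_congr rfl fun _ _ =>
      Finset.sum_congr rfl fun _ _ => by ring
  rw [h1]
  refine (Finset.abs_sum_le_sum_abs _ _).trans ?_
  -- The first vector given to `hK` enters only the bound for the derivative of the curvature, so
  -- any unit vector will do.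
  refine (Finset.sum_le_sum (g := fun _ => K) fun a _ =>
    (hK v (e a) v w (e a) (by simp [he, hv, hw])).1).trans ?_
  simp

lemma CurvatureBoundAt.covRicci_le (hK : CurvatureBoundAt G y K) (hG : IsMetric (G y))
    {u v w : Fin n → ℝ} (hu : pairing (G y) u u = 1) (hv : pairing (G y) v v = 1)
    (hw : pairing (G y) w w = 1) :
    |pairing (along (covRicci G y) u) v w| ≤ n * K := by
  obtain ⟨e, he, htr⟩ := hG.exists_frame
  have h1 : pairing (along (covRicci G y) u) v w = ∑ a, localCovRm G y u (e a) v w (e a) := by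
    have := htr (Matrix.of fun l i => ∑ m, ∑ j, ∑ k, localCovRiem G y m i j k l * u m * v j * w k)
    have e1 : pairing (along (covRicci G y) u) v w
        = ∑ i, ∑ m, ∑ j, ∑ k, localCovRiem G y m i j k i * u m * v j * w k := by
      rw [pairing_along]
      simp only [pairing, covRicci, Matrix.of_apply, Finset.sum_mul, Finset.mul_sum]
      calc _ = ∑ m, ∑ j, ∑ i, ∑ k, u m * (localCovRiem G y m i j k i * v j * w k) :=
            Finset.sum_congr rfl fun _ _ => Finset.sum_congr rfl fun _ _ => Finset.sum_comm
        _ = ∑ m, ∑ i, ∑ j, ∑ k, u m * (localCovRiem G y m i j k i * v j * w k) :=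
            Finset.sum_congr rfl fun _ _ => Finset.sum_comm
        _ = ∑ i, ∑ m, ∑ j, ∑ k, u m * (localCovRiem G y m i j k i * v j * w k) := Finset.sum_comm
        _ = _ := Finset.sum_congr rfl fun _ _ => Finset.sum_congr rfl fun _ _ =>
            Finset.sum_congr rfl fun _ _ => Finset.sum_congr rfl fun _ _ => by ring
    rw [e1]
    refine this.trans (Finset.sum_congr rfl fun a _ => ?_)
    rw [localCovRm]
    congr 1
    funext l
    simp only [Matrix.mulVec, dotProduct, Matrix.of_apply, Finset.sum_mul]
    rw [Finset.sum_comm]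
    exact Finset.sum_congr rfl fun _ _ => Finset.sum_congr rfl fun _ _ =>
      Finset.sum_congr rfl fun _ _ => Finset.sum_congr rfl fun _ _ => by ring
  rw [h1]
  refine (Finset.abs_sum_le_sum_abs _ _).trans ?_
  refine (Finset.sum_le_sum (g := fun _ => K) fun a _ =>
    (hK u (e a) v w (e a) (by simp [he, hu, hv, hw])).2).trans ?_
  simp

end LocalMetric

/-! ### Changes of coordinates -/

section Jacobian

variable {n : ℕ}

/-- The derivative of `φ` at `y`, applied to `u`. -/
def jac (φ : Coord n → Coord n) (y : Coord n) (u : Fin n → ℝ) : Fin n → ℝ :=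
  (fderiv ℝ φ y (WithLp.toLp 2 u)).ofLp

/-- The second derivative of `φ` at `y`, applied to `w` and `u`. -/
def hess (φ : Coord n → Coord n) (y : Coord n) (w u : Fin n → ℝ) : Fin n → ℝ :=
  (fderiv ℝ (fderiv ℝ φ) y (WithLp.toLp 2 w) (WithLp.toLp 2 u)).ofLp

variable {φ : Coord n → Coord n} {y : Coord n}

lemma jac_add (u v : Fin n → ℝ) : jac φ y (u + v) = jac φ y u + jac φ y v := by
  simp [jac, WithLp.toLp_add]

lemma jac_smul (r : ℝ) (u : Fin n → ℝ) : jac φ y (r • u) = r • jac φ y u := by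
  simp [jac, WithLp.toLp_smul]

lemma hess_smul_left (r : ℝ) (u v : Fin n → ℝ) : hess φ y (r • u) v = r • hess φ y u v := by
  simp [hess, WithLp.toLp_smul]

lemma hess_comm (hφ : ContDiffAt ℝ ∞ φ y) (w u : Fin n → ℝ) : hess φ y w u = hess φ y u w := by
  rw [hess, hess, (hφ.isSymmSndFDerivAt (by simpa using ENat.LEInfty.out)).eq]

lemma hasDerivWithinAt_coord_apply {γ : ℝ → Coord n} {γ' : Coord n} {s : Set ℝ} {r : ℝ}
    (hγ : HasDerivWithinAt γ γ' s r) (i : Fin n) :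
    HasDerivWithinAt (fun q => γ q i) (γ' i) s r :=
  (EuclideanSpace.proj (𝕜 := ℝ) i).hasFDerivAt.comp_hasDerivWithinAt r hγ

variable {γ : ℝ → Coord n} {γ' : Fin n → ℝ} {s : Set ℝ} {r : ℝ}

lemma hasDerivWithinAt_comp_jac (hφ : ContDiffAt ℝ ∞ φ (γ r))
    (hγ : ∀ i, HasDerivWithinAt (fun q => γ q i) (γ' i) s r) (a : Fin n) :
    HasDerivWithinAt (fun q => φ (γ q) a) (jac φ (γ r) γ' a) s r :=
  hasDerivWithinAt_coord_apply ((hφ.differentiableAt (by simp)).hasFDerivAt.comp_hasDerivWithinAt r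
    (hasDerivWithinAt_coord hγ)) a

/-- The Hessian term is the defect that keeps componentwise differentiation from being tensorial; in
`IsFlow.nabla_eq_jac` it cancels against the transformation law of the Christoffel symbols. -/
lemma hasDerivWithinAt_jac (hφ : ContDiffAt ℝ ∞ φ (γ r))
    (hγ : ∀ i, HasDerivWithinAt (fun q => γ q i) (γ' i) s r) {V : ℝ → Fin n → ℝ}
    {V' : Fin n → ℝ} (hV : ∀ i, HasDerivWithinAt (fun q => V q i) (V' i) s r) (a : Fin n) :
    HasDerivWithinAt (fun q => jac φ (γ q) (V q) a)
      ((hess φ (γ r) γ' (V r) + jac φ (γ r) V') a) s r := by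
  have h1 : DifferentiableAt ℝ (fderiv ℝ φ) (γ r) :=
    (hφ.fderiv_right (m := ∞) (by simp)).differentiableAt (by simp)
  have h2 := h1.hasFDerivAt.comp_hasDerivWithinAt r (hasDerivWithinAt_coord hγ)
  exact hasDerivWithinAt_coord_apply
    (h2.clm_apply (hasDerivWithinAt_coord (γ := fun q => WithLp.toLp 2 (V q)) hV)) a

end Jacobian

/-! ### Transformation laws of the metric derivatives and the Christoffel symbols -/

section Transformation

variable {n : ℕ} {T : ℝ} {U U' : Set (Coord n)}
  {G G' : ℝ → Coord n → Matrix (Fin n) (Fin n) ℝ}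

/-- On `O`, the map `φ` takes the coordinates of `G` to those of `G'`. -/
structure IsTransition (G G' : ℝ → Coord n → Matrix (Fin n) (Fin n) ℝ)
    (φ : Coord n → Coord n) (O : Set (Coord n)) : Prop where
  isOpen : IsOpen O
  smooth : ContDiffOn ℝ ∞ φ O
  surjective : ∀ y ∈ O, Function.Surjective (jac φ y)
  pairing_eq : ∀ (t : ℝ), ∀ y ∈ O, ∀ u v : Fin n → ℝ,
    pairing (G t y) u v = pairing (G' t (φ y)) (jac φ y u) (jac φ y v)

variable {φ : Coord n → Coord n} {O : Set (Coord n)}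

lemma IsTransition.contDiffAt (h : IsTransition G G' φ O) {y : Coord n} (hy : y ∈ O) :
    ContDiffAt ℝ ∞ φ y := h.smooth.contDiffAt (h.isOpen.mem_nhds hy)

lemma LocalMetric.hasDerivWithinAt_space (hG : LocalMetric T U G) {t : ℝ} (ht : t ∈ Set.Icc 0 T)
    {γ : ℝ → Coord n} {γ' : Fin n → ℝ} {s : Set ℝ} {r : ℝ} (hr : γ r ∈ U)
    (hγ : ∀ i, HasDerivWithinAt (fun q => γ q i) (γ' i) s r) (i j : Fin n) :
    HasDerivWithinAt (fun q => G t (γ q) i j) (along (metricDeriv (G t) (γ r)) γ' i j) s r := by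
  refine (hasDerivWithinAt_comp_space ((hG.smooth i j).differentiableAt hG.isOpen ht hr)
    hγ).congr_deriv ?_
  simp [along, Matrix.sum_apply, metricDeriv]

lemma IsTransition.pairing_metricDeriv (h : IsTransition G G' φ O) (hG : LocalMetric T U G)
    (hG' : LocalMetric T U' G') {t : ℝ} (ht : t ∈ Set.Icc 0 T) {y : Coord n} (hy : y ∈ O)
    (hyU : y ∈ U) (hyU' : φ y ∈ U') (w u v : Fin n → ℝ) :
    pairing (along (metricDeriv (G t) y) w) u v
      = pairing (along (metricDeriv (G' t) (φ y)) (jac φ y w)) (jac φ y u) (jac φ y v)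
        + pairing (G' t (φ y)) (hess φ y w u) (jac φ y v)
        + pairing (G' t (φ y)) (jac φ y u) (hess φ y w v) := by
  -- The relation `pairing_eq` is differentiated along the straight line through `y` in the
  -- direction `w`, with `u` and `v` constant.
  set γ : ℝ → Coord n := fun r => y + r • WithLp.toLp 2 w with hγdef
  have h0 : γ 0 = y := by simp [hγdef]
  have hγ : ∀ i, HasDerivWithinAt (fun q => γ q i) (w i) Set.univ 0 := by
    intro i
    have : HasDerivAt (fun q : ℝ => y i + q * w i) (w i) 0 := by
      simpa using ((hasDerivAt_id (0 : ℝ)).mul_const (w i)).const_add (y i)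
    exact this.hasDerivWithinAt
  have hc : ∀ (u : Fin n → ℝ) i, HasDerivWithinAt (fun _ : ℝ => u i) ((0 : Fin n → ℝ) i)
      Set.univ 0 := fun u i => hasDerivWithinAt_const 0 _ _
  have hl := hasDerivWithinAt_pairing (hG.hasDerivWithinAt_space ht (h0.symm ▸ hyU) hγ) (hc u) (hc v)
  have hφ : ContDiffAt ℝ ∞ φ (γ 0) := by rw [h0]; exact h.contDiffAt hy
  have hr := hasDerivWithinAt_pairing
    (hG'.hasDerivWithinAt_space ht (γ := fun r => φ (γ r)) (by simpa only [h0] using hyU')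
      (hasDerivWithinAt_comp_jac hφ hγ))
    (hasDerivWithinAt_jac hφ hγ (hc u)) (hasDerivWithinAt_jac hφ hγ (hc v))
  have hev : ∀ᶠ r in nhds (0 : ℝ), γ r ∈ O := by
    have : Continuous γ := by fun_prop
    exact this.continuousAt (by rw [h0]; exact h.isOpen.mem_nhds hy)
  rw [hasDerivWithinAt_univ] at hl hr
  have hl' := hl.congr_of_eventuallyEq
    (hev.mono fun r hr => (h.pairing_eq t (γ r) hr u v).symm)
  have := hl'.unique hr
  have hj : jac φ y 0 = 0 := by simp [jac]
  simpa only [h0, pairing_zero_left, pairing_zero_right, add_zero, hj] using this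

/-- The transformation law of the Christoffel symbols. -/
lemma IsTransition.conn_jac (h : IsTransition G G' φ O) (hG : LocalMetric T U G)
    (hG' : LocalMetric T U' G') {t : ℝ} (ht : t ∈ Set.Icc 0 T) {y : Coord n} (hy : y ∈ O)
    (hyU : y ∈ U) (hyU' : φ y ∈ U') (u v : Fin n → ℝ) :
    hess φ y u v + conn (localChristoffel (G' t) (φ y)) (jac φ y u) (jac φ y v)
      = jac φ y (conn (localChristoffel (G t) y) u v) := by
  -- It suffices to pair with vectors `jac φ y w`, as the Jacobian is surjective. In the Koszul
  -- formula all Hessian terms then cancel except the one pairing `hess φ y u v` with `jac φ y w`.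
  apply (hG'.isMetric t ht _ hyU').eq_of_pairing_eq
  intro z
  obtain ⟨w, rfl⟩ := h.surjective y hy z
  rw [← h.pairing_eq t y hy, hG.koszul ht hyU, pairing_add_left, hG'.koszul ht hyU',
    h.pairing_metricDeriv hG hG' ht hy hyU hyU', h.pairing_metricDeriv hG hG' ht hy hyU hyU',
    h.pairing_metricDeriv hG hG' ht hy hyU hyU', hess_comm (h.contDiffAt hy) v u,
    hess_comm (h.contDiffAt hy) w u, hess_comm (h.contDiffAt hy) w v,
    pairing_comm (hG'.symm t _) (jac φ y v) (hess φ y u w)]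
  ring

end Transformation

/-! ### Charts of the manifold and their transition maps -/

section Charts

variable {n : ℕ} {M : Type*} [TopologicalSpace M] [ChartedSpace (Coord n) M] [IsManifold (𝓡 n) ∞ M]
  (g : MetricFamily n M) (p q : M)

/-- The derivative of the inverse of the chart at `p`, with values in the model space. -/
def chartFrame (p : M) (y : Coord n) : Coord n →L[ℝ] Coord n :=
  mfderiv 𝓘(ℝ, Coord n) (𝓡 n) (chartAt (Coord n) p).symm y

/-- The metric at the point `b`, as a bilinear form on the model space. -/
def innerAt (t : ℝ) (b : M) : Coord n →L[ℝ] Coord n →L[ℝ] ℝ :=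
  (g t).inner b

lemma pairing_chartMetric (t : ℝ) (y : Coord n) (u v : Fin n → ℝ) :
    pairing (chartMetric g p t y) u v = innerAt g t ((chartAt (Coord n) p).symm y)
      (chartFrame p y (WithLp.toLp 2 u)) (chartFrame p y (WithLp.toLp 2 v)) := by
  have hs : ∀ u : Fin n → ℝ, WithLp.toLp 2 u = ∑ m, u m • EuclideanSpace.single m (1 : ℝ) := by
    intro u
    ext i
    simp [Pi.single_apply]
  have e : ∀ i j, chartMetric g p t y i j = innerAt g t ((chartAt (Coord n) p).symm y)
      (chartFrame p y (EuclideanSpace.single i 1)) (chartFrame p y (EuclideanSpace.single j 1)) :=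
    fun i j => rfl
  rw [hs u, hs v]
  simp only [pairing, e, map_sum, map_smul, sum_apply,
    smul_apply, smul_eq_mul, Finset.mul_sum]
  rw [Finset.sum_comm]
  exact Finset.sum_congr rfl fun i _ => Finset.sum_congr rfl fun j _ => by ring

lemma chartMetric_symm (t : ℝ) (y : Coord n) (i j : Fin n) :
    chartMetric g p t y i j = chartMetric g p t y j i :=
  (g t).symm _ _ _

/-- The derivative of the chart is a left inverse. Injectivity makes the coordinate matrix of the
metric positive definite and the transition Jacobians invertible. -/
lemma chartFrame_injective {y : Coord n} (hy : y ∈ (chartAt (Coord n) p).target) :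
    Function.Injective (chartFrame (n := n) p y) := by
  have h := (mdifferentiable_chart (I := 𝓡 n) p).comp_symm_deriv hy
  intro u v huv
  have e : ∀ u : Coord n, (mfderiv (𝓡 n) (𝓡 n) (chartAt (Coord n) p)
      ((chartAt (Coord n) p).symm y) : Coord n → Coord n) (chartFrame p y u) = u :=
    fun u => congrArg (fun L : Coord n →L[ℝ] Coord n => L u) h
  rw [← e u, ← e v, huv]

lemma isMetric_chartMetric (t : ℝ) {y : Coord n} (hy : y ∈ (chartAt (Coord n) p).target) :
    IsMetric (chartMetric g p t y) where
  symm := chartMetric_symm g p t y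
  pos u hu := by
    rw [pairing_chartMetric]
    refine (g t).pos _ _ fun h0 => hu ?_
    have := chartFrame_injective p hy (h0.trans (map_zero _).symm)
    simpa using this

variable {g} in
lemma IsRicciFlow.localRicciFlow {T : ℝ} (hT : 0 < T) (hg : IsRicciFlow T g) :
    LocalRicciFlow T (chartAt (Coord n) p).target (chartMetric g p) where
  pos_time := hT
  isOpen := (chartAt (Coord n) p).open_target
  smooth := hg.smooth p
  symm := chartMetric_symm g p
  isMetric t _ _ hy := isMetric_chartMetric g p t hy
  evolution t ht y hy := hg.evolution p y hy t ht

/-- The change of coordinates from the chart at `p` to the chart at `q`. -/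
def transition (p q : M) (y : Coord n) : Coord n :=
  chartAt (Coord n) q ((chartAt (Coord n) p).symm y)

lemma isOpen_overlap {M : Type*} [TopologicalSpace M] [ChartedSpace (Coord n) M] (p q : M) :
    IsOpen ((chartAt (Coord n) p).target ∩ (chartAt (Coord n) p).symm ⁻¹' (chartAt (Coord n) q).source) :=
  (chartAt (Coord n) p).symm.isOpen_inter_preimage (chartAt (Coord n) q).open_source

lemma contDiffOn_transition : ContDiffOn ℝ ∞ (transition p q) ((chartAt (Coord n) p).target ∩
    (chartAt (Coord n) p).symm ⁻¹' (chartAt (Coord n) q).source) := by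
  rw [← contMDiffOn_iff_contDiffOn]
  exact (contMDiffOn_chart (I := 𝓡 n) (x := q)).comp
    ((contMDiffOn_chart_symm (I := 𝓡 n) (x := p)).mono Set.inter_subset_left) fun y hy => hy.2

lemma chartFrame_comp {y : Coord n} (hy : y ∈ (chartAt (Coord n) p).target ∩
    (chartAt (Coord n) p).symm ⁻¹' (chartAt (Coord n) q).source) :
    chartFrame p y = (chartFrame q (transition p q y)).comp (fderiv ℝ (transition p q) y) := by
  have hev : (chartAt (Coord n) p).symm =ᶠ[nhds y]
      (chartAt (Coord n) q).symm ∘ transition p q := by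
    filter_upwards [(isOpen_overlap p q).mem_nhds hy] with z hz
    exact ((chartAt (Coord n) q).left_inv hz.2).symm
  have h1 : MDifferentiableAt 𝓘(ℝ, Coord n) 𝓘(ℝ, Coord n) (transition p q) y :=
    (((contDiffOn_transition p q).contDiffAt
      ((isOpen_overlap p q).mem_nhds hy)).differentiableAt (by simp)).mdifferentiableAt
  have hm : transition p q y ∈ (chartAt (Coord n) q).target := (chartAt (Coord n) q).map_source hy.2
  have h2 : MDifferentiableAt 𝓘(ℝ, Coord n) (𝓡 n) (chartAt (Coord n) q).symm (transition p q y) :=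
    mdifferentiableAt_atlas_symm (I := 𝓡 n) (chart_mem_atlas _ q) hm
  unfold chartFrame
  rw [hev.mfderiv_eq]
  have := mfderiv_comp y h2 h1
  rw [mfderiv_eq_fderiv] at this
  exact this

lemma isTransition : IsTransition (chartMetric g p) (chartMetric g q) (transition p q)
    ((chartAt (Coord n) p).target ∩
      (chartAt (Coord n) p).symm ⁻¹' (chartAt (Coord n) q).source) where
  isOpen := isOpen_overlap p q
  smooth := contDiffOn_transition p q
  surjective y hy := by
    have hinj : Function.Injective (fderiv ℝ (transition p q) y : Coord n →ₗ[ℝ] Coord n) := by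
      intro u v huv
      apply chartFrame_injective p hy.1
      rw [chartFrame_comp p q hy]
      exact congrArg (chartFrame q (transition p q y)) huv
    intro w
    obtain ⟨u, hu⟩ := LinearMap.injective_iff_surjective.1 hinj (WithLp.toLp 2 w)
    exact ⟨u.ofLp, congrArg WithLp.ofLp hu⟩
  pairing_eq t y hy u v := by
    rw [pairing_chartMetric, pairing_chartMetric, chartFrame_comp p q hy]
    have : (chartAt (Coord n) q).symm (transition p q y) = (chartAt (Coord n) p).symm y :=
      (chartAt (Coord n) q).left_inv hy.2
    rw [this]
    rfl

end Charts

/-! ### Smoothness of the geometric quantities of a curve -/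

namespace SmoothOn

variable {W : Set (ℝ × ℝ)} {f f' : ℝ → ℝ → ℝ}

lemma add (hf : SmoothOn W f) (hf' : SmoothOn W f') : SmoothOn W fun x t => f x t + f' x t :=
  ContDiffOn.add hf hf'

lemma mul (hf : SmoothOn W f) (hf' : SmoothOn W f') : SmoothOn W fun x t => f x t * f' x t :=
  ContDiffOn.mul hf hf'

lemma sum {κ : Type*} [Fintype κ] {f : κ → ℝ → ℝ → ℝ} (hf : ∀ a, SmoothOn W (f a)) :
    SmoothOn W fun x t => ∑ a, f a x t := ContDiffOn.sum fun a _ => hf a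

lemma inv (hf : SmoothOn W f) (h0 : ∀ x t, (x, t) ∈ W → f x t ≠ 0) :
    SmoothOn W fun x t => (f x t)⁻¹ :=
  ContDiffOn.inv hf fun z hz => h0 z.1 z.2 hz

lemma sqrt (hf : SmoothOn W f) (h0 : ∀ x t, (x, t) ∈ W → f x t ≠ 0) :
    SmoothOn W fun x t => √(f x t) :=
  ContDiffOn.sqrt hf fun z hz => h0 z.1 z.2 hz

lemma pairing {ι : Type} [Fintype ι] {G : ℝ → ℝ → Matrix ι ι ℝ} {u v : ℝ → ℝ → ι → ℝ}
    (hG : ∀ i j, SmoothOn W fun x t => G x t i j) (hu : ∀ i, SmoothOn W fun x t => u x t i)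
    (hv : ∀ i, SmoothOn W fun x t => v x t i) :
    SmoothOn W fun x t => pairing (G x t) (u x t) (v x t) :=
  sum fun i => sum fun j => ((hG i j).mul (hu i)).mul (hv j)

lemma conn {ι : Type} [Fintype ι] {Γ : ℝ → ℝ → ι → ι → ι → ℝ} {u v : ℝ → ℝ → ι → ℝ}
    (hΓ : ∀ k i j, SmoothOn W fun x t => Γ x t k i j) (hu : ∀ i, SmoothOn W fun x t => u x t i)
    (hv : ∀ i, SmoothOn W fun x t => v x t i) (k : ι) :
    SmoothOn W fun x t => conn (Γ x t) (u x t) (v x t) k :=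
  sum fun i => sum fun j => ((hΓ k i j).mul (hu i)).mul (hv j)

end SmoothOn

section Curves

variable {n : ℕ} {M : Type*} [TopologicalSpace M] [ChartedSpace (Coord n) M]

/-- The `(x, t)` with `t ∈ [0, T]` for which `c(x, t)` lies in the domain of the chart at `p`. -/
def curveDomain (T : ℝ) (c : Circle → ℝ → M) (p : M) : Set (ℝ × ℝ) :=
  {z | z.2 ∈ Set.Icc 0 T ∧ c (Circle.exp z.1) z.2 ∈ (chartAt (Coord n) p).source}

variable [IsManifold (𝓡 n) ∞ M]

/-- A curve-shrinking flow in a Ricci flow on a time interval of positive length. -/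
structure IsFlow (T : ℝ) (g : MetricFamily n M) (c : Circle → ℝ → M) : Prop where
  pos_time : 0 < T
  ricciFlow : IsRicciFlow T g
  curveFlow : IsCurveShrinkingFlow T g c

/-- The covariant derivative `∇^g_S V` of a vector field `V` along the curves, in the chart
at `p`. -/
def chartNabla (g : MetricFamily n M) (c : Circle → ℝ → M) (p : M) (V : ℝ → ℝ → Fin n → ℝ)
    (x t : ℝ) : Fin n → ℝ :=
  covariant (localChristoffel (chartMetric g p t) (chartCurve c p x t))
    (chartTangent g c p x t) (V x t)
    (fun k => (chartSpeed g c p x t)⁻¹ * deriv (fun x' => V x' t k) x)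

variable {T : ℝ} {g : MetricFamily n M} {c : Circle → ℝ → M} {p : M}

namespace IsFlow

lemma localRicciFlow (h : IsFlow T g c) (p : M) :
    LocalRicciFlow T (chartAt (Coord n) p).target (chartMetric g p) :=
  h.ricciFlow.localRicciFlow p h.pos_time

lemma contMDiffOn (h : IsFlow T g c) : ContMDiffOn 𝓘(ℝ, ℝ × ℝ) (𝓡 n) ∞
    (fun z : ℝ × ℝ => c (Circle.exp z.1) z.2) (Set.univ ×ˢ Set.Icc 0 T) := by
  have h1 : ContMDiff 𝓘(ℝ, ℝ × ℝ) ((𝓡 1).prod 𝓘(ℝ, ℝ)) ∞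
      (fun z : ℝ × ℝ => (Circle.exp z.1, z.2)) :=
    (contMDiff_circleExp.comp contDiff_fst.contMDiff).prodMk contDiff_snd.contMDiff
  exact h.curveFlow.smooth.comp h1.contMDiffOn fun z hz => ⟨trivial, hz.2⟩

/-- The family is continuous only on `ℝ × [0, T]`, so the preimage of an open chart domain is open
relative to that strip. -/
lemma isSlab (h : IsFlow T g c) (p : M) : IsSlab T (curveDomain (n := n) T c p) := by
  obtain ⟨V, hV, hVe⟩ := continuousOn_iff'.1 h.contMDiffOn.continuousOn _
    (chartAt (Coord n) p).open_source
  refine ⟨V, hV, hVe ▸ ?_⟩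
  ext z
  simp [curveDomain, and_comm]

lemma curve_mem (_ : IsFlow T g c) (x t : ℝ) (hz : (x, t) ∈ curveDomain (n := n) T c p) :
    chartCurve c p x t ∈ (chartAt (Coord n) p).target :=
  (chartAt (Coord n) p).map_source hz.2

lemma smooth_curve (h : IsFlow T g c) (p : M) :
    SmoothOn (curveDomain (n := n) T c p) (chartCurve (n := n) c p) := by
  rw [SmoothOn, ← contMDiffOn_iff_contDiffOn]
  exact (contMDiffOn_chart (I := 𝓡 n) (x := p)).comp (h.contMDiffOn.mono fun z hz => ⟨trivial, hz.1⟩)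
    fun z hz => hz.2

lemma smooth_coord (h : IsFlow T g c) (p : M) (i : Fin n) :
    SmoothOn (curveDomain (n := n) T c p) fun x t => (chartCurve c p x t : Coord n) i :=
  contDiffOn_euclidean.1 (h.smooth_curve p) i

lemma smooth_velocity (h : IsFlow T g c) (p : M) (i : Fin n) :
    SmoothOn (curveDomain (n := n) T c p) fun x t => chartVelocity c p x t i :=
  (h.smooth_coord p i).deriv h.pos_time (h.isSlab p)

lemma smooth_comp_curve (h : IsFlow T g c) (p : M) {f : ℝ → Coord n → ℝ}
    (hf : FieldSmooth T (chartAt (Coord n) p).target f) :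
    SmoothOn (curveDomain (n := n) T c p) fun x t => f t (chartCurve c p x t) :=
  hf.comp_curve (h.isSlab p) (h.smooth_curve p) h.curve_mem

lemma smooth_metric (h : IsFlow T g c) (p : M) (i j : Fin n) :
    SmoothOn (curveDomain (n := n) T c p) fun x t => metricAlong g c p x t i j :=
  h.smooth_comp_curve p ((h.localRicciFlow p).smooth i j)

lemma smooth_christoffel (h : IsFlow T g c) (p : M) (k i j : Fin n) :
    SmoothOn (curveDomain (n := n) T c p) fun x t =>
      localChristoffel (chartMetric g p t) (chartCurve c p x t) k i j :=
  h.smooth_comp_curve p ((h.localRicciFlow p).smooth_christoffel k i j)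

lemma isMetric (h : IsFlow T g c) {x t : ℝ} (hz : (x, t) ∈ curveDomain (n := n) T c p) :
    IsMetric (metricAlong g c p x t) :=
  (h.localRicciFlow p).isMetric t hz.1 _ (h.curve_mem x t hz)

lemma velocity_sq_pos (h : IsFlow T g c) {x t : ℝ} (hz : (x, t) ∈ curveDomain (n := n) T c p) :
    0 < pairing (metricAlong g c p x t) (chartVelocity c p x t) (chartVelocity c p x t) :=
  (h.isMetric hz).pos _ (h.curveFlow.immersed p x t hz.1 hz.2)

lemma speed_pos (h : IsFlow T g c) {x t : ℝ} (hz : (x, t) ∈ curveDomain (n := n) T c p) :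
    0 < chartSpeed g c p x t :=
  Real.sqrt_pos.2 (h.velocity_sq_pos hz)

lemma smooth_speed_sq (h : IsFlow T g c) (p : M) : SmoothOn (curveDomain (n := n) T c p)
    fun x t => pairing (metricAlong g c p x t) (chartVelocity c p x t) (chartVelocity c p x t) :=
  SmoothOn.pairing (h.smooth_metric p) (h.smooth_velocity p) (h.smooth_velocity p)

lemma smooth_speed (h : IsFlow T g c) (p : M) :
    SmoothOn (curveDomain (n := n) T c p) (chartSpeed g c p) :=
  (h.smooth_speed_sq p).sqrt fun _ _ hz => (h.velocity_sq_pos hz).ne'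

lemma smooth_speed_inv (h : IsFlow T g c) (p : M) :
    SmoothOn (curveDomain (n := n) T c p) fun x t => (chartSpeed g c p x t)⁻¹ :=
  (h.smooth_speed p).inv fun _ _ hz => (h.speed_pos hz).ne'

lemma smooth_tangent (h : IsFlow T g c) (p : M) (i : Fin n) :
    SmoothOn (curveDomain (n := n) T c p) fun x t => chartTangent g c p x t i :=
  (h.smooth_speed_inv p).mul (h.smooth_velocity p i)

lemma smooth_nabla (h : IsFlow T g c) (p : M) {V : ℝ → ℝ → Fin n → ℝ}
    (hV : ∀ i, SmoothOn (curveDomain (n := n) T c p) fun x t => V x t i) (i : Fin n) :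
    SmoothOn (curveDomain (n := n) T c p) fun x t => chartNabla g c p V x t i :=
  ((h.smooth_speed_inv p).mul ((hV i).deriv h.pos_time (h.isSlab p))).add
    (SmoothOn.conn (h.smooth_christoffel p) (h.smooth_tangent p) hV i)

lemma smooth_curvatureVector (h : IsFlow T g c) (p : M) (i : Fin n) :
    SmoothOn (curveDomain (n := n) T c p) fun x t => chartCurvatureVector g c p x t i :=
  h.smooth_nabla p (h.smooth_tangent p) i

/-! ### Independence of the chart -/

variable {q : M} {x t : ℝ}

lemma mem_overlap (_ : IsFlow T g c) (hp : (x, t) ∈ curveDomain (n := n) T c p)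
    (hq : (x, t) ∈ curveDomain (n := n) T c q) :
    chartCurve c p x t ∈ (chartAt (Coord n) p).target ∩
      (chartAt (Coord n) p).symm ⁻¹' (chartAt (Coord n) q).source := by
  refine ⟨(chartAt (Coord n) p).map_source hp.2, ?_⟩
  rw [Set.mem_preimage, chartCurve, (chartAt (Coord n) p).left_inv hp.2]
  exact hq.2

lemma transition_curve (_ : IsFlow T g c) (q : M) (hp : (x, t) ∈ curveDomain (n := n) T c p) :
    transition p q (chartCurve c p x t) = chartCurve (n := n) c q x t := by
  rw [transition, chartCurve, (chartAt (Coord n) p).left_inv hp.2, chartCurve]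

lemma hasDerivAt_coord (h : IsFlow T g c) (hp : (x, t) ∈ curveDomain (n := n) T c p) (i : Fin n) :
    HasDerivAt (fun x' => (chartCurve c p x' t : Coord n) i) (chartVelocity c p x t i) x :=
  (h.smooth_coord p i).hasDerivAt (h.isSlab p) hp

lemma velocity_eq_jac (h : IsFlow T g c) (hp : (x, t) ∈ curveDomain (n := n) T c p)
    (hq : (x, t) ∈ curveDomain (n := n) T c q) :
    chartVelocity c q x t
      = jac (transition p q) (chartCurve c p x t) (chartVelocity (n := n) c p x t) := by
  funext a
  have h1 := hasDerivWithinAt_comp_jac (γ := fun x' => chartCurve c p x' t) (r := x)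
    ((isTransition g p q).contDiffAt (h.mem_overlap hp hq))
    (fun i => (h.hasDerivAt_coord hp i).hasDerivWithinAt (s := Set.univ)) a
  rw [hasDerivWithinAt_univ] at h1
  have h2 := h1.congr_of_eventuallyEq (f₁ := fun x' => (chartCurve (n := n) c q x' t) a)
    (((h.isSlab p).eventually_x hp).mono fun x' hx' => by
      simp only [h.transition_curve q hx'])
  exact h2.deriv

lemma pairing_jac (h : IsFlow T g c) (hp : (x, t) ∈ curveDomain (n := n) T c p)
    (hq : (x, t) ∈ curveDomain (n := n) T c q) (u v : Fin n → ℝ) :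
    pairing (metricAlong g c q x t) (jac (transition p q) (chartCurve c p x t) u)
        (jac (transition p q) (chartCurve c p x t) v)
      = pairing (metricAlong g c p x t) u v := by
  rw [metricAlong, metricAlong, (isTransition g p q).pairing_eq t _ (h.mem_overlap hp hq),
    h.transition_curve q hp]

lemma speed_eq (h : IsFlow T g c) (hp : (x, t) ∈ curveDomain (n := n) T c p)
    (hq : (x, t) ∈ curveDomain (n := n) T c q) :
    chartSpeed g c q x t = chartSpeed g c p x t := by
  rw [chartSpeed, chartSpeed, h.velocity_eq_jac hp hq, h.pairing_jac hp hq]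

lemma tangent_eq_jac (h : IsFlow T g c) (hp : (x, t) ∈ curveDomain (n := n) T c p)
    (hq : (x, t) ∈ curveDomain (n := n) T c q) :
    chartTangent g c q x t
      = jac (transition p q) (chartCurve c p x t) (chartTangent g c p x t) := by
  have e : ∀ p, chartTangent g c p x t = (chartSpeed g c p x t)⁻¹ • chartVelocity c p x t :=
    fun p => rfl
  rw [e p, e q, jac_smul, h.speed_eq hp hq, h.velocity_eq_jac hp hq]

/-- Differentiating `jac φ V` along the curve produces a Hessian term, and the inhomogeneous term in
`IsTransition.conn_jac` removes it. The relation between `V` and `V'` is needed along the curve near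
`x`, not only at `x`. -/
lemma nabla_eq_jac (h : IsFlow T g c) (hp : (x, t) ∈ curveDomain (n := n) T c p)
    (hq : (x, t) ∈ curveDomain (n := n) T c q) {V V' : ℝ → ℝ → Fin n → ℝ}
    (hV : ∀ i, SmoothOn (curveDomain (n := n) T c p) fun x t => V x t i)
    (hVV' : ∀ x', (x', t) ∈ curveDomain (n := n) T c p → (x', t) ∈ curveDomain (n := n) T c q →
      V' x' t = jac (transition p q) (chartCurve c p x' t) (V x' t)) :
    chartNabla g c q V' x t
      = jac (transition p q) (chartCurve c p x t) (chartNabla g c p V x t) := by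
  have hd : ∀ a, deriv (fun x' => V' x' t a) x
      = (hess (transition p q) (chartCurve c p x t) (chartVelocity c p x t) (V x t)
        + jac (transition p q) (chartCurve c p x t) (fun k => deriv (fun x' => V x' t k) x)) a := by
    intro a
    have h1 := hasDerivWithinAt_jac (γ := fun x' => chartCurve c p x' t) (r := x)
      (V := fun x' => V x' t)
      ((isTransition g p q).contDiffAt (h.mem_overlap hp hq))
      (fun i => (h.hasDerivAt_coord hp i).hasDerivWithinAt (s := Set.univ))
      (fun i => ((hV i).hasDerivAt (h.isSlab p) hp).hasDerivWithinAt) a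
    rw [hasDerivWithinAt_univ] at h1
    have h2 := h1.congr_of_eventuallyEq (f₁ := fun x' => V' x' t a)
      ((((h.isSlab p).eventually_x hp).and ((h.isSlab q).eventually_x hq)).mono fun x' hx' => by
        simp only [hVV' x' hx'.1 hx'.2])
    exact h2.deriv
  have e : ∀ (p : M) (V : ℝ → ℝ → Fin n → ℝ), chartNabla g c p V x t
      = (chartSpeed g c p x t)⁻¹ • (fun k => deriv (fun x' => V x' t k) x)
        + conn (localChristoffel (chartMetric g p t) (chartCurve c p x t))
          (chartTangent g c p x t) (V x t) := fun p V => rfl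
  have eS : chartTangent g c p x t = (chartSpeed g c p x t)⁻¹ • chartVelocity c p x t := rfl
  have hΓ := (isTransition g p q).conn_jac (h.localRicciFlow p).toLocalMetric
    (h.localRicciFlow q).toLocalMetric hp.1 (h.mem_overlap hp hq) (h.curve_mem x t hp)
    (by rw [h.transition_curve q hp]; exact h.curve_mem x t hq) (chartTangent g c p x t) (V x t)
  rw [h.transition_curve q hp] at hΓ
  rw [e, e, jac_add, ← hΓ, jac_smul, h.speed_eq hp hq, h.tangent_eq_jac hp hq, hVV' x hp hq,
    funext hd, eS, hess_smul_left]
  funext a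
  simp only [Pi.add_apply, Pi.smul_apply, smul_eq_mul]
  ring

lemma curvatureVector_eq_jac (h : IsFlow T g c) (hp : (x, t) ∈ curveDomain (n := n) T c p)
    (hq : (x, t) ∈ curveDomain (n := n) T c q) :
    chartCurvatureVector g c q x t
      = jac (transition p q) (chartCurve c p x t) (chartCurvatureVector g c p x t) :=
  h.nabla_eq_jac hp hq (h.smooth_tangent p) fun _ hp hq => h.tangent_eq_jac hp hq

lemma nabla_curvatureVector_eq_jac (h : IsFlow T g c) (hp : (x, t) ∈ curveDomain (n := n) T c p)
    (hq : (x, t) ∈ curveDomain (n := n) T c q) :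
    chartNabla g c q (chartCurvatureVector g c q) x t
      = jac (transition p q) (chartCurve c p x t)
        (chartNabla g c p (chartCurvatureVector g c p) x t) :=
  h.nabla_eq_jac hp hq (h.smooth_curvatureVector p) fun _ hp hq => h.curvatureVector_eq_jac hp hq

/-- The transition map does not depend on time, so differentiating the transformation law of the
metric in time yields that of `-2 Ric`; the curvature tensor itself need not be transformed. -/
lemma ricci_jac (h : IsFlow T g c) (hp : (x, t) ∈ curveDomain (n := n) T c p)
    (hq : (x, t) ∈ curveDomain (n := n) T c q) (u v : Fin n → ℝ) :
    pairing (ricci (chartMetric g q t) (chartCurve c q x t))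
        (jac (transition p q) (chartCurve c p x t) u) (jac (transition p q) (chartCurve c p x t) v)
      = pairing (ricci (chartMetric g p t) (chartCurve c p x t)) u v := by
  have hd : ∀ (p : M) (_ : (x, t) ∈ curveDomain (n := n) T c p) (u v : Fin n → ℝ),
      HasDerivWithinAt (fun s => pairing (chartMetric g p s (chartCurve c p x t)) u v)
        (-2 * pairing (ricci (chartMetric g p t) (chartCurve c p x t)) u v) (Set.Icc 0 T) t := by
    intro p hp u v
    have := hasDerivWithinAt_pairing
      (G' := (-2 : ℝ) • ricci (chartMetric g p t) (chartCurve c p x t))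
      ((h.localRicciFlow p).evolution t hp.1 _ (h.curve_mem x t hp))
      (u := fun _ => u) (v := fun _ => v) (u' := 0) (v' := 0)
      (fun i => hasDerivWithinAt_const _ _ _) (fun i => hasDerivWithinAt_const _ _ _)
    simpa only [pairing_smul_matrix, pairing_zero_left, pairing_zero_right, add_zero] using this
  have h1 := hd p hp u v
  simp only [(isTransition g p q).pairing_eq _ _ (h.mem_overlap hp hq),
    h.transition_curve q hp] at h1
  have := (uniqueDiffOn_Icc h.pos_time t hp.1).eq_deriv _ h1 (hd q hq _ _)
  linarith

lemma mem_own (_ : IsFlow T g c) (x : ℝ) (ht : t ∈ Set.Icc 0 T) :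
    (x, t) ∈ curveDomain (n := n) T c (c (Circle.exp x) t) :=
  ⟨ht, mem_chart_source _ _⟩

lemma speed_eq_chart (h : IsFlow T g c) (hp : (x, t) ∈ curveDomain (n := n) T c p) :
    speed g c x t = chartSpeed g c p x t :=
  h.speed_eq hp (h.mem_own x hp.1)

/-- The chart used in `curvature` moves with `(x, t)`, whereas differentiation needs one fixed
chart. Squaring removes the root, so the right-hand side is smooth also where `H = 0`. -/
lemma curvature_sq_eq_chart (h : IsFlow T g c) (hp : (x, t) ∈ curveDomain (n := n) T c p) :
    curvature g c x t ^ 2 = pairing (metricAlong g c p x t)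
      (chartCurvatureVector g c p x t) (chartCurvatureVector g c p x t) := by
  have ho := h.mem_own x hp.1
  rw [curvature, Real.sq_sqrt ((h.isMetric ho).nonneg _), h.curvatureVector_eq_jac hp ho,
    h.pairing_jac hp ho]

lemma tangent_unit (h : IsFlow T g c) (hp : (x, t) ∈ curveDomain (n := n) T c p) :
    pairing (metricAlong g c p x t) (chartTangent g c p x t) (chartTangent g c p x t) = 1 := by
  have e : chartTangent g c p x t = (chartSpeed g c p x t)⁻¹ • chartVelocity c p x t := rfl
  have h1 := h.speed_pos hp
  rw [e, pairing_smul_left, pairing_smul_right,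
    ← Real.sq_sqrt (h.velocity_sq_pos hp).le, ← chartSpeed]
  field_simp

end IsFlow

/-! ### The Levi-Civita connection of the space-time metric -/

lemma inv_hatMetric {t : ℝ} {y : Coord n} (hG : IsUnit (chartMetric g p t y).det) :
    (hatMetric g p t y)⁻¹ = Matrix.fromBlocks (chartMetric g p t y)⁻¹ 0 0 1 := by
  apply Matrix.inv_eq_right_inv
  rw [hatMetric, Matrix.fromBlocks_multiply]
  simp [Matrix.mul_nonsing_inv _ hG]

lemma hatChristoffel_space {t : ℝ} {y : Coord n} (hG : IsUnit (chartMetric g p t y).det)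
    (k i j : Fin n) : hatChristoffel T g p t y (Sum.inl k) (Sum.inl i) (Sum.inl j)
      = localChristoffel (chartMetric g p t) y k i j := by
  rw [hatChristoffel, christoffel, inv_hatMetric hG]
  simp [christoffel, hatMetricDeriv, localChristoffel, hatMetric]

/-- The metric `ĝ` is block diagonal with `1` in the time block, so of the three terms of the
Christoffel symbol only the time derivative of the spatial block survives. Under the Ricci flow its
value is `Ric`. -/
lemma hatChristoffel_time {t : ℝ} {y : Coord n} (hG : IsUnit (chartMetric g p t y).det)
    (i j : Fin n) : hatChristoffel T g p t y (Sum.inr ()) (Sum.inl i) (Sum.inl j)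
      = -(1 / 2) * derivWithin (fun s => chartMetric g p s y i j) (Set.Icc 0 T) t := by
  rw [hatChristoffel, christoffel, inv_hatMetric hG]
  simp [hatMetricDeriv, hatMetric, partialDeriv]

lemma pairing_hatMetric {t : ℝ} {y : Coord n} (u v : Fin n → ℝ) (a b : ℝ) :
    pairing (hatMetric g p t y) (Sum.elim u fun _ => a) (Sum.elim v fun _ => b)
      = pairing (chartMetric g p t y) u v + a * b := by
  simp [pairing, hatMetric]

namespace IsFlow

variable {q : M} {x t : ℝ}

/-- Both `S` and `H` are horizontal, hence Christoffel symbols of `ĝ` with a lower time index never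
contribute. -/
lemma chartNablaSH_eq (h : IsFlow T g c) (hp : (x, t) ∈ curveDomain (n := n) T c p) :
    chartNablaSH T g c p x t = Sum.elim (chartNabla g c p (chartCurvatureVector g c p) x t)
      fun _ => pairing (ricci (chartMetric g p t) (chartCurve c p x t))
        (chartTangent g c p x t) (chartCurvatureVector g c p x t) := by
  have hG := ((h.localRicciFlow p).isMetric t hp.1 _ (h.curve_mem x t hp)).isUnit_det
  funext k
  rcases k with k | k
  · simp [chartNablaSH, covariant, chartNabla, horizontal, hatChristoffel_space hG]
  · simp only [chartNablaSH, covariant, horizontal, Fintype.sum_sum_type, hatChristoffel_time hG,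
      (h.localRicciFlow p).derivWithin_eq hp.1 (h.curve_mem x t hp), Sum.elim_inl, Sum.elim_inr,
      Finset.univ_unique, Pi.zero_apply, deriv_const, mul_zero, zero_mul,
      add_zero, zero_add, Finset.sum_const_zero, pairing, ricci, Matrix.of_apply]
    refine Finset.sum_congr rfl fun i _ => Finset.sum_congr rfl fun j _ => by ring

/-- The time direction is orthogonal to `S`, so the projection changes only the spatial part, and
Pythagoras applies. -/
lemma chartNablaSHPerp_sq (h : IsFlow T g c) (hp : (x, t) ∈ curveDomain (n := n) T c p) :
    pairing (hatMetric g p t (chartCurve c p x t)) (chartNablaSHPerp T g c p x t)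
        (chartNablaSHPerp T g c p x t)
      = pairing (metricAlong g c p x t) (chartNabla g c p (chartCurvatureVector g c p) x t)
          (chartNabla g c p (chartCurvatureVector g c p) x t)
        - pairing (metricAlong g c p x t) (chartNabla g c p (chartCurvatureVector g c p) x t)
          (chartTangent g c p x t) ^ 2
        + pairing (ricci (chartMetric g p t) (chartCurve c p x t))
          (chartTangent g c p x t) (chartCurvatureVector g c p x t) ^ 2 := by
  set P := chartNabla g c p (chartCurvatureVector g c p) x t
  set S := chartTangent g c p x t
  set ρ := pairing (ricci (chartMetric g p t) (chartCurve c p x t)) S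
    (chartCurvatureVector g c p x t)
  have hz : horizontal S = Sum.elim S fun _ : Unit => (0 : ℝ) := rfl
  have e : chartNablaSHPerp T g c p x t
      = Sum.elim (P - pairing (metricAlong g c p x t) P S • S) fun _ => ρ := by
    funext k
    simp only [chartNablaSHPerp, h.chartNablaSH_eq hp]
    rw [hz, pairing_hatMetric]
    rcases k with k | k <;> simp [metricAlong, P, S, ρ]
  have hS := h.tangent_unit hp
  rw [e, pairing_hatMetric, ← metricAlong]
  simp only [pairing_sub_left, pairing_sub_right, pairing_smul_left, pairing_smul_right]
  rw [pairing_comm (h.isMetric hp).symm S P, hS]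
  ring

lemma nablaSHPerpSq_eq_chart (h : IsFlow T g c) (hp : (x, t) ∈ curveDomain (n := n) T c p) :
    nablaSHPerpSq T g c x t
      = pairing (metricAlong g c p x t) (chartNabla g c p (chartCurvatureVector g c p) x t)
          (chartNabla g c p (chartCurvatureVector g c p) x t)
        - pairing (metricAlong g c p x t) (chartNabla g c p (chartCurvatureVector g c p) x t)
          (chartTangent g c p x t) ^ 2
        + pairing (ricci (chartMetric g p t) (chartCurve c p x t))
          (chartTangent g c p x t) (chartCurvatureVector g c p x t) ^ 2 := by
  have ho := h.mem_own x hp.1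
  rw [nablaSHPerpSq, h.chartNablaSHPerp_sq ho, h.nabla_curvatureVector_eq_jac hp ho,
    h.tangent_eq_jac hp ho, h.curvatureVector_eq_jac hp ho, h.pairing_jac hp ho,
    h.pairing_jac hp ho, h.ricci_jac hp ho]

end IsFlow

end Curves

/-! ### Covariant derivatives along the surface swept out by the curves -/

section Evolution

variable {n : ℕ} {M : Type*} [TopologicalSpace M] [ChartedSpace (Coord n) M]
  [IsManifold (𝓡 n) ∞ M]

/-- The covariant derivative `D V / ∂x`, in the chart at `p`. -/
def covX (g : MetricFamily n M) (c : Circle → ℝ → M) (p : M) (V : ℝ → ℝ → Fin n → ℝ)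
    (x t : ℝ) : Fin n → ℝ :=
  (fun k => deriv (fun x' => V x' t k) x)
    + conn (localChristoffel (chartMetric g p t) (chartCurve c p x t)) (chartVelocity c p x t) (V x t)

/-- The covariant derivative `D V / ∂t` along a curve-shrinking flow, in the chart at `p`. -/
def covT (T : ℝ) (g : MetricFamily n M) (c : Circle → ℝ → M) (p : M) (V : ℝ → ℝ → Fin n → ℝ)
    (x t : ℝ) : Fin n → ℝ :=
  (fun k => derivWithin (fun s => V x s k) (Set.Icc 0 T) t)
    + conn (localChristoffel (chartMetric g p t) (chartCurve c p x t))
      (chartCurvatureVector g c p x t) (V x t)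

variable {T : ℝ} {g : MetricFamily n M} {c : Circle → ℝ → M} {p : M} {x t : ℝ}
  {V V' : ℝ → ℝ → Fin n → ℝ} {f : ℝ → ℝ → ℝ}

lemma chartTangent_eq_smul :
    chartTangent g c p x t = (chartSpeed g c p x t)⁻¹ • chartVelocity c p x t := rfl

lemma chartNabla_eq_smul :
    chartNabla g c p V x t = (chartSpeed g c p x t)⁻¹ • covX g c p V x t := by
  rw [covX, smul_add, ← conn_smul_left, ← chartTangent_eq_smul]
  rfl

namespace IsFlow

lemma velocity_eq_smul (h : IsFlow T g c) (hz : (x, t) ∈ curveDomain (n := n) T c p) :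
    chartVelocity c p x t = chartSpeed g c p x t • chartTangent g c p x t := by
  rw [chartTangent_eq_smul, smul_inv_smul₀ (h.speed_pos hz).ne']

lemma covX_eq_smul (h : IsFlow T g c) (hz : (x, t) ∈ curveDomain (n := n) T c p) :
    covX g c p V x t = chartSpeed g c p x t • chartNabla g c p V x t := by
  rw [chartNabla_eq_smul, smul_inv_smul₀ (h.speed_pos hz).ne']

lemma covX_congr (h : IsFlow T g c) (hz : (x, t) ∈ curveDomain (n := n) T c p)
    (hV : ∀ x t, (x, t) ∈ curveDomain (n := n) T c p → V x t = V' x t) :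
    covX g c p V x t = covX g c p V' x t := by
  have : ∀ k, deriv (fun x' => V x' t k) x = deriv (fun x' => V' x' t k) x := fun k =>
    Filter.EventuallyEq.deriv_eq
      (((h.isSlab p).eventually_x hz).mono fun x' hx' => by simp only [hV x' t hx'])
  simp only [covX, this, hV x t hz]

lemma covT_congr (h : IsFlow T g c) (hz : (x, t) ∈ curveDomain (n := n) T c p)
    (hV : ∀ x t, (x, t) ∈ curveDomain (n := n) T c p → V x t = V' x t) :
    covT T g c p V x t = covT T g c p V' x t := by
  have : ∀ k, derivWithin (fun s => V x s k) (Set.Icc 0 T) t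
      = derivWithin (fun s => V' x s k) (Set.Icc 0 T) t := fun k =>
    Filter.EventuallyEq.derivWithin_eq
      (((h.isSlab p).eventually_t hz).mono fun t' ht' => by simp only [hV x t' ht'])
      (by rw [hV x t hz])
  simp only [covT, this, hV x t hz]

lemma covX_add (h : IsFlow T g c) (hz : (x, t) ∈ curveDomain (n := n) T c p)
    (hV : ∀ i, SmoothOn (curveDomain (n := n) T c p) fun x t => V x t i)
    (hV' : ∀ i, SmoothOn (curveDomain (n := n) T c p) fun x t => V' x t i) :
    covX g c p (fun x t => V x t + V' x t) x t = covX g c p V x t + covX g c p V' x t := by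
  have : (fun k => deriv (fun x' => (V x' t + V' x' t) k) x)
      = (fun k => deriv (fun x' => V x' t k) x) + fun k => deriv (fun x' => V' x' t k) x := by
    funext k
    exact (((hV k).hasDerivAt (h.isSlab p) hz).add ((hV' k).hasDerivAt (h.isSlab p) hz)).deriv
  simp only [covX, this, conn_add_right]
  abel

lemma covX_smul (h : IsFlow T g c) (hz : (x, t) ∈ curveDomain (n := n) T c p)
    (hf : SmoothOn (curveDomain (n := n) T c p) f)
    (hV : ∀ i, SmoothOn (curveDomain (n := n) T c p) fun x t => V x t i) :
    covX g c p (fun x t => f x t • V x t) x t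
      = deriv (fun x' => f x' t) x • V x t + f x t • covX g c p V x t := by
  have : (fun k => deriv (fun x' => (f x' t • V x' t) k) x)
      = deriv (fun x' => f x' t) x • V x t
        + f x t • fun k => deriv (fun x' => V x' t k) x := by
    funext k
    exact ((hf.hasDerivAt (h.isSlab p) hz).mul ((hV k).hasDerivAt (h.isSlab p) hz)).deriv
  simp only [covX, this, conn_smul_right, smul_add]
  abel

lemma covT_smul (h : IsFlow T g c) (hz : (x, t) ∈ curveDomain (n := n) T c p)
    (hf : SmoothOn (curveDomain (n := n) T c p) f)
    (hV : ∀ i, SmoothOn (curveDomain (n := n) T c p) fun x t => V x t i) :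
    covT T g c p (fun x t => f x t • V x t) x t
      = derivWithin (f x) (Set.Icc 0 T) t • V x t + f x t • covT T g c p V x t := by
  have : (fun k => derivWithin (fun s => (f x s • V x s) k) (Set.Icc 0 T) t)
      = derivWithin (f x) (Set.Icc 0 T) t • V x t
        + f x t • fun k => derivWithin (fun s => V x s k) (Set.Icc 0 T) t := by
    funext k
    exact ((hf.hasDerivWithinAt (h.isSlab p) hz).mul
      ((hV k).hasDerivWithinAt (h.isSlab p) hz)).derivWithin
        (uniqueDiffOn_Icc h.pos_time t hz.1)
  simp only [covT, this, conn_smul_right, smul_add]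
  abel

/-- At a fixed time the metric is parallel: the derivative of its coefficients along the curve is
absorbed by the Christoffel terms of `covX`. -/
lemma hasDerivAt_pairing (h : IsFlow T g c) (hz : (x, t) ∈ curveDomain (n := n) T c p)
    (hV : ∀ i, SmoothOn (curveDomain (n := n) T c p) fun x t => V x t i)
    (hV' : ∀ i, SmoothOn (curveDomain (n := n) T c p) fun x t => V' x t i) :
    HasDerivAt (fun x' => pairing (metricAlong g c p x' t) (V x' t) (V' x' t))
      (pairing (metricAlong g c p x t) (covX g c p V x t) (V' x t)
        + pairing (metricAlong g c p x t) (V x t) (covX g c p V' x t)) x := by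
  have h1 := hasDerivWithinAt_pairing (s := Set.univ)
    ((h.localRicciFlow p).hasDerivWithinAt_space hz.1 (γ := fun x' => chartCurve c p x' t)
      (h.curve_mem x t hz) fun i => (h.hasDerivAt_coord hz i).hasDerivWithinAt)
    (fun i => ((hV i).hasDerivAt (h.isSlab p) hz).hasDerivWithinAt)
    (fun i => ((hV' i).hasDerivAt (h.isSlab p) hz).hasDerivWithinAt)
  rw [hasDerivWithinAt_univ] at h1
  refine h1.congr_deriv ?_
  rw [(h.localRicciFlow p).compatible hz.1 (h.curve_mem x t hz)]
  simp only [covX, pairing_add_left, pairing_add_right, metricAlong]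
  ring

/-- Here the curve-shrinking equation enters: the velocity of `s ↦ c(x, s)` is `H`. -/
lemma hasDerivWithinAt_comp_curve (h : IsFlow T g c) (hz : (x, t) ∈ curveDomain (n := n) T c p)
    {f : ℝ → Coord n → ℝ} (hf : FieldSmooth T (chartAt (Coord n) p).target f) :
    HasDerivWithinAt (fun s => f s (chartCurve c p x s))
      (derivWithin (fun s => f s (chartCurve c p x t)) (Set.Icc 0 T) t
        + ∑ m, chartCurvatureVector g c p x t m * partialDeriv m (f t) (chartCurve c p x t))
      (Set.Icc 0 T) t :=
  hf.hasDerivWithinAt_comp h.pos_time (h.localRicciFlow p).isOpen hz.1 (h.curve_mem x t hz)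
    (h.curveFlow.equation p x t hz.1 hz.2)

/-- The motion of the point is absorbed by `covT`, as in `hasDerivAt_pairing`; the motion of the
metric leaves `-2 Ric`. -/
lemma hasDerivWithinAt_pairing (h : IsFlow T g c) (hz : (x, t) ∈ curveDomain (n := n) T c p)
    (hV : ∀ i, SmoothOn (curveDomain (n := n) T c p) fun x t => V x t i)
    (hV' : ∀ i, SmoothOn (curveDomain (n := n) T c p) fun x t => V' x t i) :
    HasDerivWithinAt (fun s => pairing (metricAlong g c p x s) (V x s) (V' x s))
      (-2 * pairing (ricci (chartMetric g p t) (chartCurve c p x t)) (V x t) (V' x t)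
        + pairing (metricAlong g c p x t) (covT T g c p V x t) (V' x t)
        + pairing (metricAlong g c p x t) (V x t) (covT T g c p V' x t)) (Set.Icc 0 T) t := by
  have hG : ∀ i j, HasDerivWithinAt (fun s => metricAlong g c p x s i j)
      (((-2 : ℝ) • ricci (chartMetric g p t) (chartCurve c p x t)
        + along (metricDeriv (chartMetric g p t) (chartCurve c p x t))
          (chartCurvatureVector g c p x t)) i j) (Set.Icc 0 T) t := by
    intro i j
    refine (h.hasDerivWithinAt_comp_curve hz ((h.localRicciFlow p).smooth i j)).congr_deriv ?_
    rw [(h.localRicciFlow p).derivWithin_eq hz.1 (h.curve_mem x t hz)]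
    simp [along, Matrix.sum_apply, metricDeriv, ricci]
  have h1 := CurveShrinking.hasDerivWithinAt_pairing hG
    (fun i => (hV i).hasDerivWithinAt (h.isSlab p) hz)
    (fun i => (hV' i).hasDerivWithinAt (h.isSlab p) hz)
  refine h1.congr_deriv ?_
  rw [pairing_add_matrix, pairing_smul_matrix,
    (h.localRicciFlow p).compatible hz.1 (h.curve_mem x t hz)]
  simp only [covT, pairing_add_left, pairing_add_right, metricAlong]
  ring

lemma derivWithin_coord (h : IsFlow T g c) (hz : (x, t) ∈ curveDomain (n := n) T c p) (i : Fin n) :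
    derivWithin (fun s => (chartCurve c p x s : Coord n) i) (Set.Icc 0 T) t
      = chartCurvatureVector g c p x t i :=
  (h.curveFlow.equation p x t hz.1 hz.2 i).derivWithin (uniqueDiffOn_Icc h.pos_time t hz.1)

lemma derivWithin_velocity (h : IsFlow T g c) (hz : (x, t) ∈ curveDomain (n := n) T c p)
    (i : Fin n) : derivWithin (fun s => chartVelocity c p x s i) (Set.Icc 0 T) t
      = deriv (fun x' => chartCurvatureVector g c p x' t i) x := by
  refine (derivWithin_deriv_comm h.pos_time (h.isSlab p) (h.smooth_coord p i) hz).trans ?_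
  exact Filter.EventuallyEq.deriv_eq
    (((h.isSlab p).eventually_x hz).mono fun x' hx' => h.derivWithin_coord hx' i)

/-- The connection is torsion-free: `D X / ∂t = D H / ∂x`. -/
lemma covT_velocity (h : IsFlow T g c) (hz : (x, t) ∈ curveDomain (n := n) T c p) :
    covT T g c p (chartVelocity c p) x t = covX g c p (chartCurvatureVector g c p) x t := by
  rw [covT, covX, funext (h.derivWithin_velocity hz),
    conn_comm ((h.localRicciFlow p).christoffel_symm t _)]

/-- The commutator of the covariant derivatives with respect to `t` and `x`. -/
lemma covT_covX (h : IsFlow T g c) (hz : (x, t) ∈ curveDomain (n := n) T c p)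
    (hV : ∀ i, SmoothOn (curveDomain (n := n) T c p) fun x t => V x t i) :
    covT T g c p (covX g c p V) x t = covX g c p (covT T g c p V) x t
      + riemApply (chartMetric g p t) (chartCurve c p x t) (chartCurvatureVector g c p x t)
        (chartVelocity c p x t) (V x t)
      + conn (christoffelDot T (chartMetric g p) t (chartCurve c p x t)) (chartVelocity c p x t)
        (V x t) := by
  have hu := uniqueDiffOn_Icc h.pos_time t hz.1
  have hL := h.localRicciFlow p
  set Γ := localChristoffel (chartMetric g p t) (chartCurve c p x t) with hΓ
  set H := chartCurvatureVector g c p x t with hH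
  set X := chartVelocity (n := n) c p x t with hX
  set Z : Fin n → ℝ := fun i => deriv (fun x' => chartCurvatureVector g c p x' t i) x with hZ
  set Vx : Fin n → ℝ := fun i => deriv (fun x' => V x' t i) x with hVx
  set Vt : Fin n → ℝ := fun i => derivWithin (fun s => V x s i) (Set.Icc 0 T) t with hVt
  set A : Fin n → ℝ := fun i =>
    derivWithin (fun s => deriv (fun x' => V x' s i) x) (Set.Icc 0 T) t with hA
  set dΓ := christoffelDeriv (chartMetric g p t) (chartCurve c p x t) with hdΓ
  set Γt := christoffelDot T (chartMetric g p) t (chartCurve c p x t) with hΓt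
  -- The two orders of differentiation share the mixed derivative `A` and, since `∂ₜ X = ∂ₓ H`, the
  -- term with `Z`. Their Christoffel derivatives form the curvature, except for `Γt`, which arises
  -- only in `D_t`.
  have e1 : (fun k => derivWithin (fun s => covX g c p V x s k) (Set.Icc 0 T) t)
      = A + (conn (Γt + along dΓ H) X (V x t) + conn Γ Z (V x t) + conn Γ X Vt) := by
    funext k
    have hΓ' : ∀ k i j, HasDerivWithinAt
        (fun s => localChristoffel (chartMetric g p s) (chartCurve c p x s) k i j)
        ((Γt + along dΓ H) k i j) (Set.Icc 0 T) t := by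
      intro k i j
      refine (h.hasDerivWithinAt_comp_curve hz (hL.smooth_christoffel k i j)).congr_deriv ?_
      simp [along, Finset.sum_apply, hdΓ, christoffelDeriv, hΓt, christoffelDot, hH]
    have h1 := hasDerivWithinAt_conn hΓ'
      (fun i => ((h.smooth_velocity p i).hasDerivWithinAt (h.isSlab p) hz).congr_deriv
        (h.derivWithin_velocity hz i))
      (fun i => (hV i).hasDerivWithinAt (h.isSlab p) hz) k
    have h2 := ((hV k).deriv h.pos_time (h.isSlab p)).hasDerivWithinAt (h.isSlab p) hz
    exact (h2.add h1).derivWithin hu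
  have e2 : (fun k => deriv (fun x' => covT T g c p V x' t k) x)
      = A + (conn (along dΓ X) H (V x t) + conn Γ Z (V x t) + conn Γ H Vx) := by
    funext k
    have hΓ' : ∀ k i j, HasDerivWithinAt
        (fun x' => localChristoffel (chartMetric g p t) (chartCurve c p x' t) k i j)
        ((along dΓ X) k i j) Set.univ x := by
      intro k i j
      refine (hasDerivWithinAt_comp_space (γ := fun x' => chartCurve c p x' t)
        (f := fun y => localChristoffel (chartMetric g p t) y k i j)
        ((hL.smooth_christoffel k i j).differentiableAt hL.isOpen hz.1 (h.curve_mem x t hz))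
        fun i => (h.hasDerivAt_coord hz i).hasDerivWithinAt).congr_deriv ?_
      simp [along, Finset.sum_apply, hdΓ, christoffelDeriv, hX]
    have h1 := hasDerivWithinAt_conn hΓ'
      (fun i => ((h.smooth_curvatureVector p i).hasDerivAt (h.isSlab p) hz).hasDerivWithinAt)
      (fun i => ((hV i).hasDerivAt (h.isSlab p) hz).hasDerivWithinAt) k
    rw [hasDerivWithinAt_univ] at h1
    have h2 := ((hV k).derivWithin h.pos_time (h.isSlab p)).hasDerivAt (h.isSlab p) hz
    rw [← derivWithin_deriv_comm h.pos_time (h.isSlab p) (hV k) hz] at h2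
    exact (h2.add h1).deriv
  have e3 : covX g c p V x t = Vx + conn Γ X (V x t) := rfl
  have e4 : covT T g c p V x t = Vt + conn Γ H (V x t) := rfl
  have e5 : ∀ Y : ℝ → ℝ → Fin n → ℝ, covT T g c p Y x t
      = (fun k => derivWithin (fun s => Y x s k) (Set.Icc 0 T) t) + conn Γ H (Y x t) :=
    fun Y => rfl
  have e6 : ∀ Y : ℝ → ℝ → Fin n → ℝ, covX g c p Y x t
      = (fun k => deriv (fun x' => Y x' t k) x) + conn Γ X (Y x t) := fun Y => rfl
  rw [e5 (covX g c p V), e6 (covT T g c p V), e1, e2, e3, e4, riemApply_eq, conn_add_right,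
    conn_add_right, conn_add]
  abel

end IsFlow

end Evolution

/-! ### The evolution of the curvature -/

section Curvature

variable {n : ℕ} {M : Type*} [TopologicalSpace M] [ChartedSpace (Coord n) M]
  [IsManifold (𝓡 n) ∞ M] {T : ℝ} {g : MetricFamily n M} {c : Circle → ℝ → M} {p : M} {x t : ℝ}

/-- The vector `∇^g_S H`, in the chart at `p`. -/
def chartNablaH (g : MetricFamily n M) (c : Circle → ℝ → M) (p : M) : ℝ → ℝ → Fin n → ℝ :=
  chartNabla g c p (chartCurvatureVector g c p)

/-- The function `Ric(S, S) + k²`, in the chart at `p`. -/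
def chartStretch (g : MetricFamily n M) (c : Circle → ℝ → M) (p : M) (x t : ℝ) : ℝ :=
  pairing (ricci (chartMetric g p t) (chartCurve c p x t)) (chartTangent g c p x t)
      (chartTangent g c p x t)
    + pairing (metricAlong g c p x t) (chartCurvatureVector g c p x t)
      (chartCurvatureVector g c p x t)

namespace IsFlow

lemma smooth_nablaH (h : IsFlow T g c) (p : M) (i : Fin n) :
    SmoothOn (curveDomain (n := n) T c p) fun x t => chartNablaH g c p x t i :=
  h.smooth_nabla p (h.smooth_curvatureVector p) i

lemma smooth_stretch (h : IsFlow T g c) (p : M) :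
    SmoothOn (curveDomain (n := n) T c p) (chartStretch g c p) :=
  (SmoothOn.pairing
    (fun i j => h.smooth_comp_curve p ((h.localRicciFlow p).smooth_ricci i j))
    (h.smooth_tangent p) (h.smooth_tangent p)).add
    (SmoothOn.pairing (h.smooth_metric p) (h.smooth_curvatureVector p) (h.smooth_curvatureVector p))

lemma covX_tangent (h : IsFlow T g c) (hz : (x, t) ∈ curveDomain (n := n) T c p) :
    covX g c p (chartTangent g c p) x t
      = chartSpeed g c p x t • chartCurvatureVector g c p x t :=
  h.covX_eq_smul hz

lemma covX_curvatureVector (h : IsFlow T g c) (hz : (x, t) ∈ curveDomain (n := n) T c p) :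
    covX g c p (chartCurvatureVector g c p) x t
      = chartSpeed g c p x t • chartNablaH g c p x t :=
  h.covX_eq_smul hz

/-- Differentiate `|S|² = 1` in `x`. -/
lemma curvatureVector_orthogonal (h : IsFlow T g c) (hz : (x, t) ∈ curveDomain (n := n) T c p) :
    pairing (metricAlong g c p x t) (chartCurvatureVector g c p x t) (chartTangent g c p x t)
      = 0 := by
  have h1 := h.hasDerivAt_pairing hz (h.smooth_tangent p) (h.smooth_tangent p)
  have h2 : HasDerivAt (fun x' => pairing (metricAlong g c p x' t) (chartTangent g c p x' t)
      (chartTangent g c p x' t)) 0 x :=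
    (hasDerivAt_const x (1 : ℝ)).congr_of_eventuallyEq
      (((h.isSlab p).eventually_x hz).mono fun x' hx' => h.tangent_unit hx')
  have := h1.unique h2
  rw [h.covX_tangent hz, pairing_smul_left, pairing_smul_right,
    pairing_comm (h.isMetric hz).symm (chartTangent g c p x t)] at this
  have hs := h.speed_pos hz
  have : chartSpeed g c p x t * pairing (metricAlong g c p x t) (chartCurvatureVector g c p x t)
    (chartTangent g c p x t) = 0 := by linarith
  exact (mul_eq_zero.1 this).resolve_left hs.ne'

/-- Differentiate `⟨H, S⟩ = 0` in `x`. -/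
lemma pairing_nablaH_tangent (h : IsFlow T g c) (hz : (x, t) ∈ curveDomain (n := n) T c p) :
    pairing (metricAlong g c p x t) (chartNablaH g c p x t) (chartTangent g c p x t)
      = -pairing (metricAlong g c p x t) (chartCurvatureVector g c p x t)
          (chartCurvatureVector g c p x t) := by
  have h1 := h.hasDerivAt_pairing hz (h.smooth_curvatureVector p) (h.smooth_tangent p)
  have h2 : HasDerivAt (fun x' => pairing (metricAlong g c p x' t)
      (chartCurvatureVector g c p x' t) (chartTangent g c p x' t)) 0 x :=
    (hasDerivAt_const x (0 : ℝ)).congr_of_eventuallyEq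
      (((h.isSlab p).eventually_x hz).mono fun x' hx' => h.curvatureVector_orthogonal hx')
  have := h1.unique h2
  rw [h.covX_tangent hz, h.covX_curvatureVector hz, pairing_smul_left, pairing_smul_right,
    ← mul_add] at this
  have := (mul_eq_zero.1 this).resolve_left (h.speed_pos hz).ne'
  linarith

/-- Differentiate `|S|² = 1` in time; the right-hand side reflects that the metric moves. -/
lemma pairing_covT_tangent (h : IsFlow T g c) (hz : (x, t) ∈ curveDomain (n := n) T c p) :
    pairing (metricAlong g c p x t) (covT T g c p (chartTangent g c p) x t) (chartTangent g c p x t)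
      = pairing (ricci (chartMetric g p t) (chartCurve c p x t)) (chartTangent g c p x t)
          (chartTangent g c p x t) := by
  have h1 := h.hasDerivWithinAt_pairing hz (h.smooth_tangent p) (h.smooth_tangent p)
  have h2 : HasDerivWithinAt (fun s => pairing (metricAlong g c p x s) (chartTangent g c p x s)
      (chartTangent g c p x s)) 0 (Set.Icc 0 T) t :=
    (hasDerivWithinAt_const t _ (1 : ℝ)).congr_of_eventuallyEq
      (((h.isSlab p).eventually_t hz).mono fun s hs => h.tangent_unit hs) (h.tangent_unit hz)
  have := (uniqueDiffOn_Icc h.pos_time t hz.1).eq_deriv _ h1 h2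
  rw [pairing_comm (h.isMetric hz).symm (chartTangent g c p x t)] at this
  linarith

/-- Expand `D_t X = D_x H` with `X = |X| S`. The component along `S` gives the evolution of the
speed, and the equation then determines `D_t S`. -/
lemma speed_evolution (h : IsFlow T g c) (hz : (x, t) ∈ curveDomain (n := n) T c p) :
    chartSpeed g c p x t • chartNablaH g c p x t
      = derivWithin (chartSpeed g c p x) (Set.Icc 0 T) t • chartTangent g c p x t
        + chartSpeed g c p x t • covT T g c p (chartTangent g c p) x t := by
  rw [← h.covX_curvatureVector hz, ← h.covT_velocity hz,
    h.covT_congr hz fun x t hz => h.velocity_eq_smul hz,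
    h.covT_smul hz (h.smooth_speed p) (h.smooth_tangent p)]

lemma derivWithin_speed (h : IsFlow T g c) (hz : (x, t) ∈ curveDomain (n := n) T c p) :
    derivWithin (chartSpeed g c p x) (Set.Icc 0 T) t
      = -(chartSpeed g c p x t * chartStretch g c p x t) := by
  have := congrArg (fun v => pairing (metricAlong g c p x t) v (chartTangent g c p x t))
    (h.speed_evolution hz)
  simp only [pairing_add_left, pairing_smul_left, h.pairing_nablaH_tangent hz, h.tangent_unit hz,
    h.pairing_covT_tangent hz] at this
  rw [chartStretch]
  linarith

/-- `D S / ∂t = ∇_S H + (Ric(S, S) + k²) S`. -/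
lemma covT_tangent (h : IsFlow T g c) (hz : (x, t) ∈ curveDomain (n := n) T c p) :
    covT T g c p (chartTangent g c p) x t
      = chartNablaH g c p x t + chartStretch g c p x t • chartTangent g c p x t := by
  have := h.speed_evolution hz
  rw [h.derivWithin_speed hz] at this
  have hs := (h.speed_pos hz).ne'
  have e : chartSpeed g c p x t • covT T g c p (chartTangent g c p) x t
      = chartSpeed g c p x t
        • (chartNablaH g c p x t + chartStretch g c p x t • chartTangent g c p x t) := by
    rw [smul_add, this]
    module
  exact smul_right_injective _ hs e

/-- The component of `D H / ∂t` in the direction of `H`. -/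
lemma pairing_covT_curvatureVector (h : IsFlow T g c)
    (hz : (x, t) ∈ curveDomain (n := n) T c p) :
    pairing (metricAlong g c p x t) (covT T g c p (chartCurvatureVector g c p) x t)
        (chartCurvatureVector g c p x t)
      = 2 * chartStretch g c p x t * pairing (metricAlong g c p x t)
          (chartCurvatureVector g c p x t) (chartCurvatureVector g c p x t)
        + pairing (metricAlong g c p x t) (chartNabla g c p (chartNablaH g c p) x t)
          (chartCurvatureVector g c p x t)
        + localRm (chartMetric g p t) (chartCurve c p x t) (chartCurvatureVector g c p x t)
          (chartTangent g c p x t) (chartTangent g c p x t) (chartCurvatureVector g c p x t)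
        + pairing (metricAlong g c p x t)
          (conn (christoffelDot T (chartMetric g p) t (chartCurve c p x t))
            (chartTangent g c p x t) (chartTangent g c p x t)) (chartCurvatureVector g c p x t) := by
  have hs := (h.speed_pos hz).ne'
  have h1 := h.covT_covX hz (h.smooth_tangent p)
  -- In the commutator for `S` the left side is `D_t(|X| H)` and the first term on the right is
  -- `D_x(∇_S H + (Ric(S, S) + k²) S)`.
  rw [h.covT_congr hz fun x t hz => h.covX_tangent hz,
    h.covT_smul hz (h.smooth_speed p) (h.smooth_curvatureVector p),
    h.covX_congr hz fun x t hz => h.covT_tangent hz,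
    h.covX_add hz (h.smooth_nablaH p) (V' := fun x t => chartStretch g c p x t •
      chartTangent g c p x t) (fun i => (h.smooth_stretch p).mul (h.smooth_tangent p i)),
    h.covX_smul hz (h.smooth_stretch p) (h.smooth_tangent p), h.covX_tangent hz,
    h.covX_eq_smul hz, h.derivWithin_speed hz, h.velocity_eq_smul hz, conn_smul_left] at h1
  have hR : riemApply (chartMetric g p t) (chartCurve c p x t) (chartCurvatureVector g c p x t)
      (chartSpeed g c p x t • chartTangent g c p x t) (chartTangent g c p x t)
      = chartSpeed g c p x t • riemApply (chartMetric g p t) (chartCurve c p x t)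
        (chartCurvatureVector g c p x t) (chartTangent g c p x t) (chartTangent g c p x t) := by
    funext l
    simp only [riemApply, Pi.smul_apply, smul_eq_mul, Finset.mul_sum]
    exact Finset.sum_congr rfl fun _ _ => Finset.sum_congr rfl fun _ _ =>
      Finset.sum_congr rfl fun _ _ => by ring
  rw [hR] at h1
  have h2 := congrArg (fun v => pairing (metricAlong g c p x t) v
    (chartCurvatureVector g c p x t)) h1
  -- Pairing with `H` kills the multiple of `S` that contains the derivative of `chartStretch`. The
  -- factor `2` of `chartStretch` in the result comes once from `∂ₜ|X|` and once from `D_t S`.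
  have hSH := (pairing_comm (h.isMetric hz).symm _ _).trans (h.curvatureVector_orthogonal hz)
  simp only [pairing_add_left, pairing_smul_left, hSH] at h2
  rw [localRm_eq, ← metricAlong]
  apply mul_left_cancel₀ hs
  linear_combination h2

lemma derivWithin_curvature_sq (h : IsFlow T g c) (hz : (x, t) ∈ curveDomain (n := n) T c p) :
    derivWithin (fun s => curvature g c x s ^ 2) (Set.Icc 0 T) t
      = -2 * pairing (ricci (chartMetric g p t) (chartCurve c p x t))
          (chartCurvatureVector g c p x t) (chartCurvatureVector g c p x t)
        + 2 * pairing (metricAlong g c p x t) (covT T g c p (chartCurvatureVector g c p) x t)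
          (chartCurvatureVector g c p x t) := by
  have h1 := h.hasDerivWithinAt_pairing hz (h.smooth_curvatureVector p) (h.smooth_curvatureVector p)
  have h2 := h1.congr_of_eventuallyEq (f₁ := fun s => curvature g c x s ^ 2)
    (((h.isSlab p).eventually_t hz).mono fun s hs => h.curvature_sq_eq_chart hs)
    (h.curvature_sq_eq_chart hz)
  rw [h2.derivWithin (uniqueDiffOn_Icc h.pos_time t hz.1),
    pairing_comm (h.isMetric hz).symm (chartCurvatureVector g c p x t)]
  ring

lemma arcDeriv_curvature_sq (h : IsFlow T g c) (hz : (x, t) ∈ curveDomain (n := n) T c p) :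
    arcDeriv g c (fun x' t' => curvature g c x' t' ^ 2) x t
      = 2 * pairing (metricAlong g c p x t) (chartNablaH g c p x t)
        (chartCurvatureVector g c p x t) := by
  have h1 := h.hasDerivAt_pairing hz (h.smooth_curvatureVector p) (h.smooth_curvatureVector p)
  have h2 := h1.congr_of_eventuallyEq (f₁ := fun x' => curvature g c x' t ^ 2)
    (((h.isSlab p).eventually_x hz).mono fun x' hx' => h.curvature_sq_eq_chart hx')
  have hs := (h.speed_pos hz).ne'
  rw [arcDeriv, h2.deriv, h.speed_eq_chart hz, h.covX_curvatureVector hz,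
    pairing_comm (h.isMetric hz).symm (chartCurvatureVector g c p x t), pairing_smul_left]
  field_simp
  ring

lemma arcDeriv_arcDeriv_curvature_sq (h : IsFlow T g c)
    (hz : (x, t) ∈ curveDomain (n := n) T c p) :
    arcDeriv g c (arcDeriv g c fun x' t' => curvature g c x' t' ^ 2) x t
      = 2 * pairing (metricAlong g c p x t) (chartNabla g c p (chartNablaH g c p) x t)
          (chartCurvatureVector g c p x t)
        + 2 * pairing (metricAlong g c p x t) (chartNablaH g c p x t) (chartNablaH g c p x t) := by
  have h1 := (h.hasDerivAt_pairing hz (h.smooth_nablaH p) (h.smooth_curvatureVector p)).const_mul 2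
  have h2 := h1.congr_of_eventuallyEq
    (f₁ := fun x' => arcDeriv g c (fun x' t' => curvature g c x' t' ^ 2) x' t)
    (((h.isSlab p).eventually_x hz).mono fun x' hx' => h.arcDeriv_curvature_sq hx')
  have hs := (h.speed_pos hz).ne'
  rw [arcDeriv, h2.deriv, h.speed_eq_chart hz, h.covX_curvatureVector hz, h.covX_eq_smul hz,
    pairing_smul_left, pairing_smul_right]
  field_simp

/-- The evolution equation of `k²`. -/
lemma curvature_evolution (h : IsFlow T g c) (hz : (x, t) ∈ curveDomain (n := n) T c p) :
    derivWithin (fun s => curvature g c x s ^ 2) (Set.Icc 0 T) t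
      = arcDeriv g c (arcDeriv g c fun x' t' => curvature g c x' t' ^ 2) x t
        - 2 * nablaSHPerpSq T g c x t + 2 * curvature g c x t ^ 4
        + (2 * pairing (ricci (chartMetric g p t) (chartCurve c p x t))
            (chartTangent g c p x t) (chartCurvatureVector g c p x t) ^ 2
          + 4 * pairing (ricci (chartMetric g p t) (chartCurve c p x t))
            (chartTangent g c p x t) (chartTangent g c p x t) * curvature g c x t ^ 2
          - 2 * pairing (ricci (chartMetric g p t) (chartCurve c p x t))
            (chartCurvatureVector g c p x t) (chartCurvatureVector g c p x t)
          + 2 * localRm (chartMetric g p t) (chartCurve c p x t) (chartCurvatureVector g c p x t)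
            (chartTangent g c p x t) (chartTangent g c p x t) (chartCurvatureVector g c p x t)
          - 4 * pairing (along (covRicci (chartMetric g p t) (chartCurve c p x t))
            (chartTangent g c p x t)) (chartTangent g c p x t) (chartCurvatureVector g c p x t)
          + 2 * pairing (along (covRicci (chartMetric g p t) (chartCurve c p x t))
            (chartCurvatureVector g c p x t)) (chartTangent g c p x t)
            (chartTangent g c p x t)) := by
  have h4 : curvature g c x t ^ 4 = (curvature g c x t ^ 2) ^ 2 := by ring
  have hΓ := (h.localRicciFlow p).pairing_christoffelDot hz.1 (h.curve_mem x t hz)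
    (chartTangent g c p x t) (chartTangent g c p x t) (chartCurvatureVector g c p x t)
  have hp := h.pairing_nablaH_tangent hz
  rw [chartNablaH] at hp
  -- The stretch term contributes `4 k⁴`, and replacing `|∇^g_S H|²` by its normal part takes away
  -- `2 k⁴` and adds `2 Ric(S, H)²`.
  rw [h.derivWithin_curvature_sq hz, h.arcDeriv_arcDeriv_curvature_sq hz,
    h.nablaSHPerpSq_eq_chart hz, h.pairing_covT_curvatureVector hz, h4,
    h.curvature_sq_eq_chart hz, hp, ← chartNablaH, metricAlong, hΓ, chartStretch, metricAlong]
  ring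

end IsFlow

end Curvature

/-! ### Estimates -/

section Estimates

variable {n : ℕ} {M : Type*} [TopologicalSpace M] [ChartedSpace (Coord n) M]
  [IsManifold (𝓡 n) ∞ M] {T : ℝ} {g : MetricFamily n M} {c : Circle → ℝ → M} {p : M} {x t : ℝ}

/-- The curvature inequality at `(x, t)`. -/
def CurvatureInequalityAt (T : ℝ) (g : MetricFamily n M) (c : Circle → ℝ → M) (C x t : ℝ) : Prop :=
  derivWithin (fun s => curvature g c x s ^ 2) (Set.Icc 0 T) t ≤
    arcDeriv g c (arcDeriv g c fun x' t' => curvature g c x' t' ^ 2) x t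
      - 2 * nablaSHPerpSq T g c x t + 2 * curvature g c x t ^ 4
      + C * (curvature g c x t ^ 2 + curvature g c x t)

lemma curvature_nonneg : 0 ≤ curvature g c x t := Real.sqrt_nonneg _

lemma CurvatureInequalityAt.mono {C C' : ℝ} (h : CurvatureInequalityAt T g c C x t) (hC : C ≤ C') :
    CurvatureInequalityAt T g c C' x t := by
  have hk : 0 ≤ curvature g c x t ^ 2 + curvature g c x t :=
    add_nonneg (sq_nonneg _) curvature_nonneg
  exact h.trans (add_le_add_right (mul_le_mul_of_nonneg_right hC hk) _)

/-- The constant in the curvature inequality, for the dimension `n` and the bound `K`. -/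
def curvatureConst (n : ℕ) (K : ℝ) : ℝ :=
  2 * (n * K) ^ 2 + 6 * (n * K) + 2 * K

/-- A bound for the lower-order terms in the evolution equation of `k²`: here `r₁`, `r₂`, `r₃` stand
for the values of the Ricci tensor, `R` for that of the curvature tensor and `d₁`, `d₂` for those of
the derivative of the Ricci tensor on unit vectors. -/
lemma lower_order_le {k K N r₁ r₂ r₃ R d₁ d₂ : ℝ} (hk : 0 ≤ k) (h₁ : |r₁| ≤ N) (h₂ : |r₂| ≤ N)
    (h₃ : |r₃| ≤ N) (hR : |R| ≤ K) (h₄ : |d₁| ≤ N) (h₅ : |d₂| ≤ N) :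
    2 * (k * r₁) ^ 2 + 4 * r₂ * k ^ 2 - 2 * (k ^ 2 * r₃) + 2 * (k ^ 2 * R) - 4 * (k * d₁)
      + 2 * (k * d₂) ≤ (2 * N ^ 2 + 6 * N + 2 * K) * (k ^ 2 + k) := by
  have hN : 0 ≤ N := (abs_nonneg _).trans h₁
  have hK : 0 ≤ K := (abs_nonneg _).trans hR
  have e1 : r₁ ^ 2 ≤ N ^ 2 := sq_le_sq' (abs_le.1 h₁).1 (abs_le.1 h₁).2
  have hk2 := sq_nonneg k
  have a1 := mul_le_mul_of_nonneg_left e1 hk2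
  have a2 := mul_le_mul_of_nonneg_left (abs_le.1 h₂).2 hk2
  have a3 := mul_le_mul_of_nonneg_left (abs_le.1 h₃).1 hk2
  have a4 := mul_le_mul_of_nonneg_left (abs_le.1 hR).2 hk2
  have a5 := mul_le_mul_of_nonneg_left (abs_le.1 h₄).1 hk
  have a6 := mul_le_mul_of_nonneg_left (abs_le.1 h₅).2 hk
  -- The terms linear in `k` need only `6 N`; these two inequalities allow the full constant as the
  -- coefficient of `k`.
  have b1 : 0 ≤ N ^ 2 * k := by positivity
  have b2 : 0 ≤ K * k := by positivity
  linarith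

lemma IsFlow.exists_unit (h : IsFlow T g c) (hz : (x, t) ∈ curveDomain (n := n) T c p) :
    ∃ E : Fin n → ℝ, pairing (metricAlong g c p x t) E E = 1 ∧
      chartCurvatureVector g c p x t = curvature g c x t • E := by
  have hk := h.curvature_sq_eq_chart hz
  by_cases hH : chartCurvatureVector g c p x t = 0
  -- Where `H = 0` the curvature is `0` and any unit vector serves; `S` is at hand.
  · refine ⟨_, h.tangent_unit hz, ?_⟩
    rw [hH, pairing_zero_left] at hk
    rw [hH, pow_eq_zero_iff (two_ne_zero) |>.1 hk, zero_smul]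
  · have hpos := (h.isMetric hz).pos _ hH
    rw [← hk] at hpos
    have hne : curvature g c x t ≠ 0 := fun h0 => by simp [h0] at hpos
    refine ⟨(curvature g c x t)⁻¹ • chartCurvatureVector g c p x t, ?_, ?_⟩
    · rw [pairing_smul_left, pairing_smul_right, ← hk]
      field_simp
    · rw [smul_inv_smul₀ hne]

lemma IsFlow.curvatureInequalityAt (h : IsFlow T g c) (hz : (x, t) ∈ curveDomain (n := n) T c p)
    {K : ℝ} (hK : CurvatureBoundAt (chartMetric g p t) (chartCurve c p x t) K) :
    CurvatureInequalityAt T g c (curvatureConst n K) x t := by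
  obtain ⟨E, hE, hH⟩ := h.exists_unit hz
  have hS := h.tangent_unit hz
  have hG := h.isMetric hz
  rw [CurvatureInequalityAt, h.curvature_evolution hz, hH]
  refine add_le_add_right ?_ _
  set S := chartTangent g c p x t
  set k := curvature g c x t
  have hRm : localRm (chartMetric g p t) (chartCurve c p x t) (k • E) S S (k • E)
      = k ^ 2 * localRm (chartMetric g p t) (chartCurve c p x t) E S S E := by
    have : riemApply (chartMetric g p t) (chartCurve c p x t) (k • E) S S
        = k • riemApply (chartMetric g p t) (chartCurve c p x t) E S S := by
      funext l
      simp only [riemApply, Pi.smul_apply, smul_eq_mul, Finset.mul_sum]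
      exact Finset.sum_congr rfl fun _ _ => Finset.sum_congr rfl fun _ _ =>
        Finset.sum_congr rfl fun _ _ => by ring
    rw [localRm_eq, localRm_eq, this, pairing_smul_left, pairing_smul_right]
    ring
  have hal : pairing (along (covRicci (chartMetric g p t) (chartCurve c p x t)) (k • E)) S S
      = k * pairing (along (covRicci (chartMetric g p t) (chartCurve c p x t)) E) S S := by
    rw [pairing_along, pairing_along, Finset.mul_sum]
    exact Finset.sum_congr rfl fun _ _ => by simp only [Pi.smul_apply, smul_eq_mul]; ring
  have := lower_order_le (k := k) curvature_nonneg (hK.ricci_le hG hS hE) (hK.ricci_le hG hS hS)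
    (hK.ricci_le hG hE hE) (hK S E S S E (by simpa using ⟨hS, hE, hS, hE⟩)).1
    (hK.covRicci_le hG hS hS hE) (hK.covRicci_le hG hE hS hS)
  rw [hRm, hal, curvatureConst]
  simp only [pairing_smul_left, pairing_smul_right]
  linarith

/-- On compact sets of coordinates the curvature and its derivative are bounded. -/
lemma LocalMetric.exists_curvatureBound {U : Set (Coord n)}
    {G : ℝ → Coord n → Matrix (Fin n) (Fin n) ℝ} (h : LocalMetric T U G) {Q : Set (Coord n)}
    (hQ : IsCompact Q) (hQU : Q ⊆ U) :
    ∃ K, ∀ t ∈ Set.Icc 0 T, ∀ y ∈ Q, CurvatureBoundAt (G t) y K := by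
  have hcont : ∀ {f : ℝ → Coord n → ℝ} {Y : Type} [TopologicalSpace Y] (B : Set Y),
      FieldSmooth T U f → ContinuousOn (fun z : (ℝ × Coord n) × Y => f z.1.1 z.1.2)
        ((Set.Icc 0 T ×ˢ Q) ×ˢ B) := fun B hf =>
    ContinuousOn.comp (g := fun q : ℝ × Coord n => _) hf.continuousOn continuousOn_fst
      fun z hz => ⟨hz.1.1, hQU hz.1.2⟩
  have hc0 : IsCompact (Set.Icc 0 T ×ˢ Q) := isCompact_Icc.prod hQ
  -- `B` bounds `1 / g(w, w)` for `w` on the coordinate unit sphere, by compactness. For a `g`-unit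
  -- vector `u` and `w = u / ‖u‖` this quotient equals `‖u‖²`, so all `g`-unit vectors lie in one
  -- coordinate ball.
  obtain ⟨B, hB⟩ : ∃ B : ℝ, ∀ t ∈ Set.Icc 0 T, ∀ y ∈ Q, ∀ u : Fin n → ℝ,
      pairing (G t y) u u = 1 → ‖u‖ ≤ √B := by
    have hne : ∀ z ∈ (Set.Icc 0 T ×ˢ Q) ×ˢ Metric.sphere (0 : Fin n → ℝ) 1,
        pairing (G z.1.1 z.1.2) z.2 z.2 ≠ 0 := fun z hz =>
      ((h.isMetric _ hz.1.1 _ (hQU hz.1.2)).pos _ (by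
        rintro h0
        have := hz.2
        simp [h0] at this)).ne'
    have hco : ContinuousOn (fun z : (ℝ × Coord n) × (Fin n → ℝ) =>
        (pairing (G z.1.1 z.1.2) z.2 z.2)⁻¹)
        ((Set.Icc 0 T ×ˢ Q) ×ˢ Metric.sphere (0 : Fin n → ℝ) 1) := by
      refine ContinuousOn.inv₀ ?_ hne
      refine continuousOn_finsetSum _ fun i _ => continuousOn_finsetSum _ fun j _ => ?_
      exact ((hcont _ (h.smooth i j)).mul (by fun_prop)).mul (by fun_prop)
    obtain ⟨B, hB⟩ := (hc0.prod (isCompact_sphere _ _)).exists_bound_of_continuousOn hco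
    refine ⟨B, fun t ht y hy u hu => Real.le_sqrt_of_sq_le ?_⟩
    have hu0 : u ≠ 0 := by
      rintro rfl
      simp [pairing_zero_left] at hu
    have := hB ((t, y), ‖u‖⁻¹ • u) ⟨⟨ht, hy⟩, by
      simp [norm_smul, inv_mul_cancel₀ (norm_ne_zero_iff.2 hu0)]⟩
    simp only [pairing_smul_left, pairing_smul_right, hu, mul_one] at this
    refine le_trans (le_of_eq ?_) this
    rw [mul_inv_rev, inv_inv, Real.norm_of_nonneg (by positivity), sq]
  -- The five vectors `a, u, v, w, z` form one point of a compact ball, on which the two curvature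
  -- expressions are continuous.
  have hc := hc0.prod (isCompact_closedBall (0 : Fin 5 → Fin n → ℝ) (√B))
  obtain ⟨K₁, hK₁⟩ := hc.exists_bound_of_continuousOn
    (f := fun z : (ℝ × Coord n) × (Fin 5 → Fin n → ℝ) =>
      localRm (G z.1.1) z.1.2 (z.2 1) (z.2 2) (z.2 3) (z.2 4)) (by
    simp only [localRm, pairing]
    refine continuousOn_finsetSum _ fun i _ => continuousOn_finsetSum _ fun j _ => ?_
    refine ((hcont _ (h.smooth i j)).mul ?_).mul (by fun_prop)
    refine continuousOn_finsetSum _ fun a _ => continuousOn_finsetSum _ fun b _ =>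
      continuousOn_finsetSum _ fun c _ => ?_
    exact (((hcont _ (h.smooth_riem _ _ _ _)).mul (by fun_prop)).mul (by fun_prop)).mul
      (by fun_prop))
  obtain ⟨K₂, hK₂⟩ := hc.exists_bound_of_continuousOn
    (f := fun z : (ℝ × Coord n) × (Fin 5 → Fin n → ℝ) =>
      localCovRm (G z.1.1) z.1.2 (z.2 0) (z.2 1) (z.2 2) (z.2 3) (z.2 4)) (by
    simp only [localCovRm, pairing]
    refine continuousOn_finsetSum _ fun i _ => continuousOn_finsetSum _ fun j _ => ?_
    refine ((hcont _ (h.smooth i j)).mul ?_).mul (by fun_prop)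
    refine continuousOn_finsetSum _ fun m _ => continuousOn_finsetSum _ fun a _ =>
      continuousOn_finsetSum _ fun b _ => continuousOn_finsetSum _ fun c _ => ?_
    exact ((((hcont _ (h.smooth_covRiem _ _ _ _ _)).mul (by fun_prop)).mul (by fun_prop)).mul
      (by fun_prop)).mul (by fun_prop))
  refine ⟨max K₁ K₂, fun t ht y hy a u v w z hb => ?_⟩
  have hmem : ((t, y), ![a, u, v, w, z]) ∈
      (Set.Icc 0 T ×ˢ Q) ×ˢ Metric.closedBall (0 : Fin 5 → Fin n → ℝ) (√B) := by
    refine ⟨⟨ht, hy⟩, ?_⟩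
    rw [mem_closedBall_zero_iff, pi_norm_le_iff_of_nonneg (Real.sqrt_nonneg _)]
    intro i
    refine hB t ht y hy _ (hb _ ?_)
    fin_cases i <;> simp
  exact ⟨(hK₁ _ hmem).trans (le_max_left _ _), (hK₂ _ hmem).trans (le_max_right _ _)⟩

lemma exists_curvatureInequality_const [CompactSpace M] (hT : 0 < T) (hg : IsRicciFlow T g) :
    ∃ C : ℝ, ∀ c : Circle → ℝ → M, IsCurveShrinkingFlow T g c → CurvatureInequality T g c C := by
  -- The claim is recast as a property of sets of points `q` of `M`, with `C` chosen before the
  -- curves. It passes to subsets and to finite unions, so by compactness a local constant near each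
  -- point is enough.
  suffices H : ∃ C : ℝ, ∀ q ∈ (Set.univ : Set M), ∀ c : Circle → ℝ → M,
      IsCurveShrinkingFlow T g c → ∀ x, ∀ t ∈ Set.Icc 0 T, c (Circle.exp x) t = q →
        CurvatureInequalityAt T g c C x t by
    obtain ⟨C, hC⟩ := H
    exact ⟨C, fun c hc x t ht => hC _ trivial c hc x t ht rfl⟩
  refine isCompact_univ.induction_on
    (p := fun N : Set M => ∃ C : ℝ, ∀ q ∈ N, ∀ c : Circle → ℝ → M,
      IsCurveShrinkingFlow T g c → ∀ x, ∀ t ∈ Set.Icc 0 T, c (Circle.exp x) t = q →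
        CurvatureInequalityAt T g c C x t) ⟨0, by simp⟩ ?_ ?_ ?_
  · rintro N N' hN ⟨C, hC⟩
    exact ⟨C, fun q hq => hC q (hN hq)⟩
  · rintro N N' ⟨C, hC⟩ ⟨C', hC'⟩
    refine ⟨max C C', fun q hq c hc x t ht hx => ?_⟩
    rcases hq with hq | hq
    · exact (hC q hq c hc x t ht hx).mono (le_max_left _ _)
    · exact (hC' q hq c hc x t ht hx).mono (le_max_right _ _)
  · intro p _
    have hL := hg.localRicciFlow p hT
    obtain ⟨ε, hε, hball⟩ := Metric.nhds_basis_closedBall.mem_iff.1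
      ((chartAt (Coord n) p).open_target.mem_nhds (mem_chart_target _ p))
    obtain ⟨K, hK⟩ := hL.exists_curvatureBound (isCompact_closedBall _ ε) hball
    refine ⟨(chartAt (Coord n) p).source ∩ chartAt (Coord n) p ⁻¹'
      Metric.closedBall (chartAt (Coord n) p p) ε, ?_, curvatureConst n K, ?_⟩
    · refine mem_nhdsWithin_of_mem_nhds (Filter.inter_mem
        ((chartAt (Coord n) p).open_source.mem_nhds (mem_chart_source _ p)) ?_)
      exact ((chartAt (Coord n) p).continuousAt (mem_chart_source _ p))
        (Metric.closedBall_mem_nhds _ hε)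
    · rintro q hq c hc x t ht rfl
      exact IsFlow.curvatureInequalityAt ⟨hT, hg, hc⟩ (p := p) ⟨ht, hq.1⟩ (hK t ht _ hq.2)

/-- The bound `K` is given at each point in the chart centred there, so the evolution equation is
evaluated in the chart at `c(x, t)` itself. -/
lemma curvatureInequality_of_bound (hT : 0 < T) (hg : IsRicciFlow T g) {K : ℝ}
    (hK : CurvatureBoundedBy T g K) (hc : IsCurveShrinkingFlow T g c) :
    CurvatureInequality T g c (curvatureConst n K) := by
  intro x t ht
  have h : IsFlow T g c := ⟨hT, hg, hc⟩
  exact h.curvatureInequalityAt (h.mem_own x ht) (hK _ t ht)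

end Estimates

end

end CurveShrinking

theorem mainTheorem2 :
    (∀ (n : ℕ) (M : Type*) [TopologicalSpace M] [T2Space M] [CompactSpace M]
      [ChartedSpace (CurveShrinking.Coord n) M] [IsManifold (𝓡 n) ∞ M]
      (T : ℝ) (_ : 0 < T) (g : CurveShrinking.MetricFamily n M)
      (_ : CurveShrinking.IsRicciFlow T g),
      ∃ C : ℝ, ∀ c : Circle → ℝ → M, CurveShrinking.IsCurveShrinkingFlow T g c →
        CurveShrinking.CurvatureInequality T g c C) ∧
    (∀ (n : ℕ) (K : ℝ), ∃ C : ℝ,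
      ∀ (M : Type*) [TopologicalSpace M] [T2Space M] [CompactSpace M]
      [ChartedSpace (CurveShrinking.Coord n) M] [IsManifold (𝓡 n) ∞ M]
      (T : ℝ) (_ : 0 < T) (g : CurveShrinking.MetricFamily n M)
      (_ : CurveShrinking.IsRicciFlow T g) (_ : CurveShrinking.CurvatureBoundedBy T g K),
      ∀ c : Circle → ℝ → M, CurveShrinking.IsCurveShrinkingFlow T g c →
        CurveShrinking.CurvatureInequality T g c C) := by
  refine ⟨fun n M _ _ _ _ _ T hT g hg => ?_, fun n K => ?_⟩
  · exact CurveShrinking.exists_curvatureInequality_const hT hg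
  · exact ⟨CurveShrinking.curvatureConst n K, fun M _ _ _ _ _ T hT g hg hK c hc =>
      CurveShrinking.curvatureInequality_of_bound hT hg hK hc⟩
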